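/- Let $K$ be a field of characteristic $0$, let $t\in K$ be nonzero and not a root of unity, and let $u_1,u_2\in K\setminus\{0\}$. Let $b^{(i)}_{\pm n}$ ($i=1,2$, $n\ge 1$) be bosons with $[b^{(i)}_n,b^{(j)}_{m}]=\frac{n}{1-t^{|n|}}\,\delta_{i,j}\delta_{n+m,0}$, acting on the Fock space $\mathcal F_{\vec u}=K[b^{(1)}_{-n},b^{(2)}_{-n}:n\ge1]\,|\vec u\rangle$ with $b^{(i)}_n|\vec u\rangle=0$ for $n>0$. Let $\langle\vec u|$ be the dual vacuum, with $\langle \vec u|b^{(i)}_{-n}=0$ for $n>0$ and $\langle\vec u|\vec u\rangle=1$, and let $U_i$ act on $\mathcal F_{\vec u}$ as the scalar $u_i$. Put $$\tilde\Lambda^1(z)=\exp\Big(\sum_{n>0}\tfrac{1-t^{-n}}{n}z^n b^{(1)}_{-n}\Big)\exp\Big(-\sum_{n>0}\tfrac{1-t^{n}}{n}z^{-n} b^{(1)}_{n}\Big)U_1,$$ $$\tilde\Lambda^2(z)=\exp\Big(\sum_{n>0}\tfrac{1-t^{-n}}{n}z^n \big(b^{(2)}_{-n}-b^{(1)}_{-n}\big)\Big)\exp\Big(-\sum_{n>0}\tfrac{1-t^{n}}{n}z^{-n}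 b^{(2)}_{n}\Big)U_2,$$ $$\tilde X^{(2)}(z)=\exp\Big(\sum_{n>0}\tfrac{1-t^{-n}}{n}z^n b^{(2)}_{-n}\Big)\exp\Big(-\sum_{n>0}\tfrac{1-t^{n}}{n}z^{-n} \big(b^{(1)}_{n}+b^{(2)}_n\big)\Big)U_1U_2 .$$ Let $\tilde X^{(2)}_n$ be the coefficient of $z^{-n}$ in $\tilde X^{(2)}(z)$, and let $\tilde X^{(1)}_n$ be the coefficient of $z^{-n}$ in $\theta[n\ge0]\tilde\Lambda^1(z)+\theta[n\le0]\tilde\Lambda^2(z)$, where $\theta[P]$ is $1$ if $P$ holds and $0$ otherwise. For a pair of partitions $\vec\lambda=(\lambda^{(1)},\lambda^{(2)})$ put $|\vec\lambda|=|\lambda^{(1)}|+|\lambda^{(2)}|$ and $$|\tilde X_{\vec\lambda}\rangle=\tilde X^{(2)}_{-\lambda^{(2)}_1}\tilde X^{(2)}_{-\lambda^{(2)}_2}\cdots\tilde X^{(1)}_{-\lambda^{(1)}_1}\tilde X^{(1)}_{-\lambda^{(1)}_2}\cdots|\vec u\rangle,\qquad \langle\tilde X_{\vec\lambda}|=\langle\vec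 u|\cdots\tilde X^{(1)}_{\lambda^{(1)}_2}\tilde X^{(1)}_{\lambda^{(1)}_1}\cdots\tilde X^{(2)}_{\lambda^{(2)}_2}\tilde X^{(2)}_{\lambda^{(2)}_1},$$ and let $S_{\vec\lambda,\vec\mu}=\langle\tilde X_{\vec\lambda}|\tilde X_{\vec\mu}\rangle$ be the Shapovalov matrix. Then $S_{\vec\lambda,\vec\mu}=0$ whenever $|\vec\lambda|\ne|\vec\mu|$, and for every $n\ge 0$ the finite block $(S_{\vec\lambda,\vec\mu})_{|\vec\lambda|=|\vec\mu|=n}$ is invertible. Writing $S^{\vec\lambda,\vec\mu}$ for the entries of the (blockwise) inverse matrix, for every partition $\lambda$ $$S^{(\emptyset,(1^{|\lambda|})),(\emptyset,\lambda)}=S^{(\emptyset,\lambda),(\emptyset,(1^{|\lambda|}))}=\frac{(-1)^{|\lambda|}\,t^{-n(\lambda)}\,(u_1u_2)^{-|\lambda|-\ell(\lambda)}}{b_\lambda(t^{-1})},$$ where $\ell(\lambda)$ is the number of parts of $\lambda$, $n(\lambda)=\sum_{i\ge1}(i-1)\lambda_i$, and $b_\lambda(x)=\prod_{i\ge1}\prod_{k=1}^{m_i(\lambda)}(1-x^k)$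 with $m_i(\lambda)$ the multiplicity of the part $i$ in $\lambda$. -/

import Mathlib

open Finset

noncomputable section

namespace Crystal

/-- The Fock space generated by `|u₁,u₂⟩`: polynomials in the creation operators.  The variable
`(i, k)` is `b^{(i+1)}_{-k}` (`i = 0, 1`, `k ≥ 1`), and the polynomial `1` is `|u₁,u₂⟩`. -/
abbrev Fock (K : Type*) [Field K] : Type _ := MvPolynomial (Fin 2 × ℕ+) K

section Operators

variable {K : Type*} [Field K]

/-- `b^{(i)}_{-k}`, acting by multiplication. -/
def bMinus (i : Fin 2) (k : ℕ+) : Module.End K (Fock K) :=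
  LinearMap.mulLeft K (MvPolynomial.X (i, k))

/-- `b^{(i)}_{k}`, acting by `k / (1 - t^k) * ∂ / ∂ b^{(i)}_{-k}`. -/
def bPlus (t : K) (i : Fin 2) (k : ℕ+) : Module.End K (Fock K) :=
  (((k : ℕ) : K) / (1 - t ^ (k : ℕ))) • (MvPolynomial.pderiv (i, k)).toLinearMap

/-- The Heisenberg relation `[b^{(i)}_k, b^{(j)}_{-l}] = k / (1 - t^k) δ_{i,j} δ_{k,l}`. -/
theorem bPlus_bMinus_commutator (t : K) (i j : Fin 2) (k l : ℕ+) :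
    bPlus t i k * bMinus j l - bMinus j l * bPlus t i k =
      (if i = j ∧ k = l then ((k : ℕ) : K) / (1 - t ^ (k : ℕ)) else 0) •
        (1 : Module.End K (Fock K)) := by
  refine LinearMap.ext fun v => ?_
  by_cases h : i = j ∧ k = l
  · obtain ⟨rfl, rfl⟩ := h
    simp [bPlus, bMinus, Derivation.leibniz, smul_add]
  · have h' : ((j, l) : Fin 2 × ℕ+) ≠ (i, k) := by
      intro e
      rw [Prod.mk.injEq] at e
      exact h ⟨e.1.symm, e.2.symm⟩
    simp [bPlus, bMinus, Derivation.leibniz, MvPolynomial.pderiv_X_of_ne h', h]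

/-- The coefficient of `z^n` in `exp (∑_{k ≥ 1} x_k z^k) = ∑_j (∑_{k ≥ 1} x_k z^k)^j / j!`
(the terms with `j > n` do not contribute). -/
def expCoeff (x : ℕ+ → Module.End K (Fock K)) (n : ℕ) : Module.End K (Fock K) :=
  ∑ j ∈ range (n + 1), ((j.factorial : K)⁻¹) •
    PowerSeries.coeff n
      ((PowerSeries.mk fun k : ℕ => if h : 0 < k then x ⟨k, h⟩ else 0) ^ j)

/-- The coefficient of `z^{-n}` in the vertex operator
`exp (∑_i ∑_{k ≥ 1} α_i(k) z^k b^{(i)}_{-k}) exp (∑_i ∑_{k ≥ 1} β_i(k) z^{-k} b^{(i)}_{k})`,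
applied to `v`.  Only finitely many summands are nonzero, because high modes of the second
exponential annihilate the polynomial `v`. -/
def vertexMode (t : K) (α β : Fin 2 → ℕ+ → K) (n : ℤ) (v : Fock K) : Fock K :=
  ∑ᶠ (r : ℕ) (s : ℕ) (_ : (s : ℤ) - (r : ℤ) = n),
    expCoeff (fun k => ∑ i, α i k • bMinus i k) r
      (expCoeff (fun k => ∑ i, β i k • bPlus t i k) s v)

/-- `(1 - t^{-k}) / k` -/
def cMinus (t : K) (k : ℕ+) : K := (1 - t⁻¹ ^ (k : ℕ)) / ((k : ℕ) : K)

/-- `-(1 - t^k) / k` -/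
def cPlus (t : K) (k : ℕ+) : K := -((1 - t ^ (k : ℕ)) / ((k : ℕ) : K))

/-- Modes of `Λ¹(z) = exp (∑ (1-t^{-k})/k z^k b¹_{-k}) exp (-∑ (1-t^k)/k z^{-k} b¹_k) U₁`, where
`U₁` acts on the Fock space by `u₁`. -/
def Lambda1 (t u₁ : K) (n : ℤ) (v : Fock K) : Fock K :=
  u₁ • vertexMode t ![cMinus t, 0] ![cPlus t, 0] n v

/-- Modes of `Λ²(z) = exp (-∑ (1-t^{-k})/k z^k b¹_{-k}) exp (∑ (1-t^{-k})/k z^k b²_{-k})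
exp (-∑ (1-t^k)/k z^{-k} b²_k) U₂`, where `U₂` acts on the Fock space by `u₂`. -/
def Lambda2 (t u₂ : K) (n : ℤ) (v : Fock K) : Fock K :=
  u₂ • vertexMode t ![-cMinus t, cMinus t] ![0, cPlus t] n v

/-- The first generator: `X¹_n = ∮ dz/(2πiz) {θ[n ≥ 0] Λ¹(z) + θ[n ≤ 0] Λ²(z)} z^n`. -/
def X1 (t u₁ u₂ : K) (n : ℤ) (v : Fock K) : Fock K :=
  (if 0 ≤ n then Lambda1 t u₁ n v else 0) + (if n ≤ 0 then Lambda2 t u₂ n v else 0)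

/-- The second generator: `X²_n = ∮ dz/(2πiz) :Λ¹(z) Λ²(z): z^n`, where the normally ordered
product is `exp (∑ (1-t^{-k})/k z^k b²_{-k}) exp (-∑ (1-t^k)/k z^{-k} (b¹_k + b²_k)) U₁ U₂`. -/
def X2 (t u₁ u₂ : K) (n : ℤ) (v : Fock K) : Fock K :=
  (u₁ * u₂) • vertexMode t ![0, cMinus t] ![cPlus t, cPlus t] n v

end Operators

/-- The parts `λ₁ ≥ λ₂ ≥ ⋯` of a partition. -/
def partsList {n : ℕ} (lam : n.Partition) : List ℕ := lam.parts.sort (· ≥ ·)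

/-- The length `ℓ(λ)`. -/
def len {n : ℕ} (lam : n.Partition) : ℕ := lam.parts.card

/-- `n(λ) = ∑_{i ≥ 1} (i - 1) λ_i`. -/
def nStat {n : ℕ} (lam : n.Partition) : ℕ :=
  ∑ i ∈ range (partsList lam).length, i * (partsList lam).getD i 0

/-- `b_λ(x) = ∏_{i ≥ 1} ∏_{k = 1}^{m_i(λ)} (1 - x^k)`; a part size with `m_i = 0` contributes `1`. -/
def bFactor {K : Type*} [Field K] {n : ℕ} (lam : n.Partition) (x : K) : K :=
  ∏ i ∈ lam.parts.toFinset, ∏ k ∈ Icc 1 (lam.parts.count i), (1 - x ^ k)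

/-- The empty partition. -/
def emptyPartition : Nat.Partition 0 := ⟨0, by simp, by simp⟩

/-- The partition `(1^n)`. -/
def onePartition (n : ℕ) : n.Partition :=
  ⟨Multiset.replicate n 1, fun h => by simp [Multiset.eq_of_mem_replicate h], by simp⟩

/-- Pairs of partitions `(λ¹, λ²)` with `|λ¹| + |λ²| = n`. -/
abbrev BiPartition (n : ℕ) : Type :=
  Σ ab : {ab : ℕ × ℕ // ab ∈ antidiagonal n}, ab.1.1.Partition × ab.1.2.Partition

/-- The pair `(∅, λ)`. -/
def emptyPair {n : ℕ} (lam : n.Partition) : BiPartition n :=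
  ⟨⟨(0, n), by simp⟩, (emptyPartition, lam)⟩

section Shapovalov

variable {K : Type*} [Field K]

/-- `|X_{λ¹,λ²}⟩ = X²_{-λ²₁} X²_{-λ²₂} ⋯ X¹_{-λ¹₁} X¹_{-λ¹₂} ⋯ |u₁,u₂⟩`. -/
def ket (t u₁ u₂ : K) {n : ℕ} (v : BiPartition n) : Fock K :=
  (partsList v.2.2).foldr (fun k w => X2 t u₁ u₂ (-(k : ℤ)) w)
    ((partsList v.2.1).foldr (fun k w => X1 t u₁ u₂ (-(k : ℤ)) w) 1)

/-- `⟨X_{λ¹,λ²}| = ⟨u₁,u₂| ⋯ X¹_{λ¹₂} X¹_{λ¹₁} ⋯ X²_{λ²₂} X²_{λ²₁}`, as a functional on the Fock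
space; `⟨u₁,u₂|` is the functional killed by all `b^{(i)}_{-k}` with `⟨u₁,u₂|u₁,u₂⟩ = 1`, that is,
the constant term. -/
def bra (t u₁ u₂ : K) {n : ℕ} (v : BiPartition n) (w : Fock K) : K :=
  MvPolynomial.constantCoeff
    ((partsList v.2.1).foldl (fun w' k => X1 t u₁ u₂ (k : ℤ) w')
      ((partsList v.2.2).foldl (fun w' k => X2 t u₁ u₂ (k : ℤ) w') w))

/-- The Shapovalov matrix element `S_{λ,μ} = ⟨X_λ|X_μ⟩`, for pairs of partitions of any sizes. -/
def shapovalov (t u₁ u₂ : K) {m n : ℕ} (v : BiPartition m) (w : BiPartition n) : K :=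
  bra t u₁ u₂ v (ket t u₁ u₂ w)

/-- The block of the Shapovalov matrix at level `n`. -/
def shapovalovMatrix (t u₁ u₂ : K) (n : ℕ) : Matrix (BiPartition n) (BiPartition n) K :=
  Matrix.of fun v w => shapovalov t u₁ u₂ v w

end Shapovalov

end Crystal

end

/-! Put `s = t⁻¹`. The proof splits the Fock space so that the Shapovalov form becomes a product of
two pairings of Hall–Littlewood functions. In the creation variables `b²` and `b² - b¹`, the modes
of `X²` act only on the `b²` factor, because `b¹_k + b²_k` commutes with every `b²_{-l} - b¹_{-l}`.
The modes of `Λ²` act within the polynomials in `b² - b¹`. On its own factor each is, up to a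
scalar, Jing's vertex operator, so a ket is a scalar times `Q_{λ²}(b²) Q_{λ¹}(b² - b¹)`. On the bra
side, after the modes of `X²`, only `Λ¹` acts. It does not involve the second boson, so `b²` may be
set to `0`; this leaves the constant term of the first factor and applies `ι : p_k ↦ -p_k` to the
second. Since `ι` exchanges the two charges of vertex operators, an entry of `S` is a scalar times
`⟨Q_{λ¹}, Q_{μ¹}⟩ ⟨Q_{λ²}, ι Q_{μ²}⟩` (`shapovalov_eq`).

The first pairing is diagonal with entries `b_λ(s)` (`dualFun_qFun`). This follows from an exchange
relation for vertex operators of opposite charge (`vertex_exchange`), and together with a dimension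
count it makes the `Q_λ` a basis in each degree. Hence the second pairing `P` is the matrix of the
involution `ι`, and its inverse is `P_{λμ} / (b_λ b_μ)`.

The row and column of `P⁻¹` at `(1^n)` are found by exhibiting preimages of a basis vector. For the
column, `h_n` pairs with `Q_λ` to `s^{n(λ)}`, while `ι h_n` pairs to zero unless `λ = (1^n)`. For
the row, the specialization `p_k ↦ 1 / (1 - s^k)` sends `Q_λ` to `s^{n(λ)}`, and `ι Q_λ` to zero
unless `λ = (1^n)`. -/

noncomputable section

namespace Crystal

/-! ### Exponentials of power series over a possibly noncommutative algebra. -/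

section ExpSeries

variable {K : Type*} [Field K] {A : Type*} [Ring A] [Algebra K A]

/-- The power series `∑_{k ≥ 1} x_k z^k`. -/
def posSeries (x : ℕ+ → A) : PowerSeries A :=
  PowerSeries.mk fun k : ℕ => if h : 0 < k then x ⟨k, h⟩ else 0

variable (K) in
/-- The power series `exp (∑_{k ≥ 1} x_k z^k)`. -/
def expSeries (x : ℕ+ → A) : PowerSeries A :=
  PowerSeries.mk fun n => ∑ j ∈ range (n + 1), ((j.factorial : K)⁻¹) •
    PowerSeries.coeff n (posSeries x ^ j)

/-- The Euler operator `z d/dz`. -/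
def euler (F : PowerSeries A) : PowerSeries A :=
  PowerSeries.mk fun n => (n : A) * PowerSeries.coeff n F

@[simp] theorem coeff_euler (F : PowerSeries A) (n : ℕ) :
    PowerSeries.coeff n (euler F) = (n : A) * PowerSeries.coeff n F := PowerSeries.coeff_mk _ _

theorem coeff_zero_posSeries (x : ℕ+ → A) : PowerSeries.coeff 0 (posSeries x) = 0 := by
  simp [posSeries]

theorem coeff_posSeries (x : ℕ+ → A) {n : ℕ} (hn : 0 < n) :
    PowerSeries.coeff n (posSeries x) = x ⟨n, hn⟩ := by
  simp [posSeries, hn]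

theorem euler_mul (F G : PowerSeries A) : euler (F * G) = euler F * G + F * euler G := by
  ext n
  simp only [coeff_euler, PowerSeries.coeff_mul, map_add, mul_sum, ← sum_add_distrib]
  refine sum_congr rfl fun p hp => ?_
  rw [← mem_antidiagonal.mp hp, ← mul_assoc (PowerSeries.coeff p.1 F), ← Nat.cast_comm p.2]
  push_cast
  noncomm_ring

theorem euler_pow_succ {F : PowerSeries A} (h : Commute F (euler F)) (j : ℕ) :
    euler (F ^ (j + 1)) = ((j + 1 : ℕ) : PowerSeries A) * (euler F * F ^ j) := by
  induction j with
  | zero => simp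
  | succ j ih =>
    rw [pow_succ, euler_mul, ih, (h.pow_left (j + 1)).eq, mul_assoc, mul_assoc, ← pow_succ]
    push_cast
    noncomm_ring

theorem coeff_mul_posSeries_pow_eq_zero (x : ℕ+ → A) (F : PowerSeries A) {m j : ℕ}
    (hm : m < j) : PowerSeries.coeff m (F * posSeries x ^ j) = 0 := by
  induction j generalizing F m with
  | zero => omega
  | succ j ih =>
    rw [pow_succ, ← mul_assoc, PowerSeries.coeff_mul]
    refine sum_eq_zero fun p hp => ?_
    have hp := mem_antidiagonal.mp hp
    rcases Nat.eq_zero_or_pos p.2 with h0 | h0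
    · rw [h0, coeff_zero_posSeries, mul_zero]
    · rw [ih F (by omega), zero_mul]

theorem coeff_posSeries_pow_eq_zero (x : ℕ+ → A) {m j : ℕ} (hm : m < j) :
    PowerSeries.coeff m (posSeries x ^ j) = 0 := by
  simpa using coeff_mul_posSeries_pow_eq_zero x 1 hm

theorem coeff_expSeries_of_le (x : ℕ+ → A) {n N : ℕ} (h : n ≤ N) :
    PowerSeries.coeff n (expSeries K x) = ∑ j ∈ range (N + 1), ((j.factorial : K)⁻¹) •
      PowerSeries.coeff n (posSeries x ^ j) := by
  rw [expSeries, PowerSeries.coeff_mk]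
  refine sum_subset (range_subset_range.2 (by omega)) fun j _ hj => ?_
  rw [coeff_posSeries_pow_eq_zero x (by simpa using hj), smul_zero]

@[simp] theorem coeff_zero_expSeries (x : ℕ+ → A) :
    PowerSeries.coeff 0 (expSeries K x) = 1 := by
  simp [expSeries]

theorem commute_posSeries_euler {x : ℕ+ → A} (hx : ∀ k l, Commute (x k) (x l)) :
    Commute (posSeries x) (euler (posSeries x)) := by
  have key : ∀ i j, Commute (PowerSeries.coeff i (posSeries x))
      (PowerSeries.coeff j (posSeries x)) := by
    intro i j
    rcases Nat.eq_zero_or_pos i with rfl | hi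
    · rw [coeff_zero_posSeries]; exact Commute.zero_left _
    rcases Nat.eq_zero_or_pos j with rfl | hj
    · rw [coeff_zero_posSeries]; exact Commute.zero_right _
    rw [coeff_posSeries x hi, coeff_posSeries x hj]
    exact hx _ _
  refine PowerSeries.ext fun n => ?_
  rw [PowerSeries.coeff_mul, PowerSeries.coeff_mul, ← Finset.Nat.sum_antidiagonal_swap]
  refine sum_congr rfl fun p _ => ?_
  simp only [coeff_euler, Prod.fst_swap, Prod.snd_swap]
  exact ((Nat.commute_cast _ _).mul_right (key _ _)).eq

theorem map_expSeries {B : Type*} [Ring B] [Algebra K B] (f : A →ₐ[K] B) (x : ℕ+ → A) :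
    PowerSeries.map (f : A →+* B) (expSeries K x) = expSeries K fun k => f (x k) := by
  have h : PowerSeries.map (f : A →+* B) (posSeries x) = posSeries fun k => f (x k) := by
    ext n
    simp only [posSeries, PowerSeries.coeff_map, PowerSeries.coeff_mk]
    split_ifs <;> simp
  ext n
  simp only [PowerSeries.coeff_map, expSeries, PowerSeries.coeff_mk, RingHom.coe_coe, map_sum,
    map_smul, ← h, ← map_pow]

variable [CharZero K]

/-- The equation `z F' = (z P') F` is what characterizes the exponential of `P`. Commutativity of
the `x k` is needed to differentiate the powers of `P`. -/
theorem euler_expSeries {x : ℕ+ → A} (hx : ∀ k l, Commute (x k) (x l)) :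
    euler (expSeries K x) = euler (posSeries x) * expSeries K x := by
  have hc := commute_posSeries_euler hx
  ext n
  have h1 : ∀ p ∈ antidiagonal n, PowerSeries.coeff p.1 (euler (posSeries x)) *
      PowerSeries.coeff p.2 (expSeries K x) = ∑ j ∈ range (n + 1), ((j.factorial : K)⁻¹) •
        (PowerSeries.coeff p.1 (euler (posSeries x)) *
          PowerSeries.coeff p.2 (posSeries x ^ j)) := by
    intro p hp
    rw [coeff_expSeries_of_le (N := n) x (by have := mem_antidiagonal.mp hp; omega), mul_sum]
    simp only [mul_smul_comm]
  -- The left side is expanded with one extra term, so that after the `j = 0` term is dropped its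
  -- index `j + 1` matches `j` on the right.
  rw [PowerSeries.coeff_mul, sum_congr rfl h1, sum_comm, coeff_euler,
    coeff_expSeries_of_le x (Nat.le_succ n), mul_sum, sum_range_succ']
  have h0 : (n : A) * ((((Nat.factorial 0 : ℕ) : K)⁻¹) •
      PowerSeries.coeff n (posSeries x ^ 0)) = 0 := by
    rcases Nat.eq_zero_or_pos n with rfl | hn
    · simp
    · simp [PowerSeries.coeff_one, hn.ne']
  rw [h0, add_zero]
  refine sum_congr rfl fun j _ => ?_
  rw [← smul_sum, ← PowerSeries.coeff_mul, mul_smul_comm, ← coeff_euler, euler_pow_succ hc]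
  have : ((j + 1 : ℕ) : PowerSeries A) * (euler (posSeries x) * posSeries x ^ j) =
      (j + 1) • (euler (posSeries x) * posSeries x ^ j) := by rw [nsmul_eq_mul]
  rw [this, map_nsmul, ← Nat.cast_smul_eq_nsmul K, smul_smul, Nat.factorial_succ]
  congr 1
  have h2 : ((j + 1 : ℕ) : K) ≠ 0 := by exact_mod_cast Nat.succ_ne_zero j
  have h3 : (j.factorial : K) ≠ 0 := by exact_mod_cast j.factorial_ne_zero
  push_cast at h2 ⊢
  field_simp

/-- Since `euler P` has no constant term, the equation expresses `n` times the `n`-th coefficient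
through lower ones, and `n` is invertible in characteristic zero. -/
theorem eq_of_euler_eq_mul (K : Type*) [Field K] [CharZero K] {A : Type*} [Ring A] [Algebra K A]
    {P F G : PowerSeries A} (hF : euler F = euler P * F)
    (hG : euler G = euler P * G) (h0 : PowerSeries.coeff 0 F = PowerSeries.coeff 0 G) : F = G := by
  ext n
  induction n using Nat.strong_induction_on with
  | _ n ih =>
    rcases Nat.eq_zero_or_pos n with rfl | hn
    · exact h0
    have h : (n : A) * PowerSeries.coeff n F = (n : A) * PowerSeries.coeff n G := by
      rw [← coeff_euler, ← coeff_euler, hF, hG, PowerSeries.coeff_mul, PowerSeries.coeff_mul]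
      refine sum_congr rfl fun p hp => ?_
      have hp := mem_antidiagonal.mp hp
      rcases Nat.eq_zero_or_pos p.1 with h0 | h0
      · simp [h0]
      · rw [ih p.2 (by omega)]
    rw [← nsmul_eq_mul, ← nsmul_eq_mul, ← Nat.cast_smul_eq_nsmul K,
      ← Nat.cast_smul_eq_nsmul K] at h
    exact smul_right_injective A (Nat.cast_ne_zero.2 hn.ne' : (n : K) ≠ 0) h

end ExpSeries

/-! ### Commutative exponentials: additivity, geometric series and `(1 - s x) / (1 - x)`. -/

section CommExpSeries

variable {K : Type*} [Field K] [CharZero K] {R : Type*} [CommRing R] [Algebra K R]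

theorem expSeries_eq {x : ℕ+ → R} {F : PowerSeries R} (hF : euler F = euler (posSeries x) * F)
    (h0 : PowerSeries.coeff 0 F = 1) : expSeries K x = F :=
  eq_of_euler_eq_mul K (euler_expSeries fun _ _ => Commute.all _ _) hF
    ((coeff_zero_expSeries x).trans h0.symm)

theorem expSeries_add (x y : ℕ+ → R) :
    expSeries K (fun k => x k + y k) = expSeries K x * expSeries K y := by
  refine expSeries_eq ?_ (by simp [PowerSeries.coeff_mul])
  rw [euler_mul, euler_expSeries (fun k l => Commute.all (x k) (x l)),
    euler_expSeries (fun k l => Commute.all (y k) (y l))]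
  have : euler (posSeries (fun k => x k + y k)) = euler (posSeries x) + euler (posSeries y) := by
    ext n
    rcases Nat.eq_zero_or_pos n with rfl | hn
    · rw [map_add, coeff_euler, coeff_euler, coeff_euler]
      simp
    · simp [coeff_posSeries _ hn, mul_add]
  rw [this]
  ring

theorem expSeries_zero : expSeries K (fun _ => (0 : R)) = 1 := by
  refine expSeries_eq ?_ (by simp)
  ext n
  rcases Nat.eq_zero_or_pos n with rfl | hn
  · rw [PowerSeries.coeff_mul]
    simp [coeff_zero_posSeries]
  · have : posSeries (fun _ => (0 : R)) = 0 := by ext; simp [posSeries]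
    simp [this, PowerSeries.coeff_one, hn.ne']

theorem expSeries_mul_neg (x : ℕ+ → R) : expSeries K x * expSeries K (fun k => -x k) = 1 := by
  simp only [← expSeries_add, add_neg_cancel, expSeries_zero]

theorem expSeries_pow_div (y : R) :
    expSeries K (fun k => (((k : ℕ) : K)⁻¹) • y ^ (k : ℕ)) = PowerSeries.mk fun n => y ^ n := by
  refine expSeries_eq ?_ (by simp)
  ext n
  rw [PowerSeries.coeff_mul, coeff_euler, PowerSeries.coeff_mk]
  rw [Finset.Nat.sum_antidiagonal_eq_sum_range_succ_mk, sum_range_succ']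
  simp only [coeff_euler, Nat.cast_zero, zero_mul, add_zero]
  rw [← nsmul_eq_mul, ← card_range n, ← sum_const, card_range]
  refine sum_congr rfl fun i hi => ?_
  have hi := mem_range.1 hi
  have h2 : ((i + 1 : ℕ) : K) ≠ 0 := by exact_mod_cast Nat.succ_ne_zero i
  rw [coeff_posSeries _ (Nat.succ_pos i), PowerSeries.coeff_mk, ← nsmul_eq_mul,
    ← Nat.cast_smul_eq_nsmul K, smul_smul]
  simp only [PNat.mk_coe, Nat.succ_eq_add_one]
  rw [mul_inv_cancel₀ h2, one_smul, ← pow_add]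
  congr 1
  omega

theorem expSeries_neg_pow_div (y : R) :
    expSeries K (fun k => -((((k : ℕ) : K)⁻¹) • y ^ (k : ℕ))) =
      1 - PowerSeries.C y * PowerSeries.X := by
  have h := expSeries_mul_neg (K := K) (fun k : ℕ+ => (((k : ℕ) : K)⁻¹) • y ^ (k : ℕ))
  have h2 : (1 - PowerSeries.C y * PowerSeries.X) *
      expSeries K (fun k : ℕ+ => (((k : ℕ) : K)⁻¹) • y ^ (k : ℕ)) = 1 := by
    rw [expSeries_pow_div]
    ext n
    cases n with
    | zero => simp
    | succ n =>
      rw [sub_mul, mul_assoc, one_mul, map_sub, PowerSeries.coeff_C_mul,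
        PowerSeries.coeff_succ_X_mul]
      simp [PowerSeries.coeff_one, pow_succ, mul_comm]
  calc _ = ((1 - PowerSeries.C y * PowerSeries.X) *
      expSeries K (fun k : ℕ+ => (((k : ℕ) : K)⁻¹) • y ^ (k : ℕ))) *  _ := by rw [h2, one_mul]
    _ = _ := by rw [mul_assoc, h, mul_one]

/-- The coefficients of `(1 - s x) / (1 - x)`. -/
def gcoef (s : K) (a : ℕ) : K := if a = 0 then 1 else 1 - s

/-- The exponent is `log ((1 - s y z) / (1 - y z))`. This is the scalar factor that arises when two
vertex operators are normally ordered. -/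
theorem expSeries_one_sub_pow_div (s : K) (y : R) :
    expSeries K (fun k => ((1 - s ^ (k : ℕ)) / ((k : ℕ) : K)) • y ^ (k : ℕ)) =
      PowerSeries.mk fun n => gcoef s n • y ^ n := by
  have h : (fun k : ℕ+ => ((1 - s ^ (k : ℕ)) / ((k : ℕ) : K)) • y ^ (k : ℕ)) =
      fun k : ℕ+ => (((k : ℕ) : K)⁻¹) • y ^ (k : ℕ) +
        -((((k : ℕ) : K)⁻¹) • (s • y) ^ (k : ℕ)) := by
    funext k
    rw [smul_pow, smul_smul, ← neg_smul, ← add_smul]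
    congr 1
    ring
  rw [h, expSeries_add, expSeries_pow_div, expSeries_neg_pow_div]
  ext n
  cases n with
  | zero => simp [gcoef]
  | succ n =>
    rw [mul_sub, mul_one, mul_comm (PowerSeries.C _), ← mul_assoc, map_sub,
      PowerSeries.coeff_mul_C, PowerSeries.coeff_succ_mul_X]
    simp [gcoef, sub_smul, pow_succ]

end CommExpSeries

/-! ### Exponentials of constant-coefficient derivations are translations. -/

section Shift

variable {K : Type*} [Field K] {σ : Type*}

/-- The translation `X_i ↦ X_i + β_i y^{d_i}`, with values in polynomials in `y`. -/
def shift (d : σ → ℕ+) (β : σ → K) :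
    MvPolynomial σ K →ₐ[K] Polynomial (MvPolynomial σ K) :=
  MvPolynomial.aeval fun i => Polynomial.C (MvPolynomial.X i) +
    Polynomial.C (MvPolynomial.C (β i)) * Polynomial.X ^ (d i : ℕ)

@[simp] theorem shift_X (d : σ → ℕ+) (β : σ → K) (i : σ) :
    shift d β (MvPolynomial.X i) = Polynomial.C (MvPolynomial.X i) +
      Polynomial.C (MvPolynomial.C (β i)) * Polynomial.X ^ (d i : ℕ) := by
  simp [shift]

@[simp] theorem shift_C (d : σ → ℕ+) (β : σ → K) (c : K) :
    shift d β (MvPolynomial.C c) = Polynomial.C (MvPolynomial.C c) :=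
  (shift d β).commutes c

variable {R : Type*} [CommRing R] [Algebra K R]

/-- A derivation acting on the coefficients of a power series. -/
def coeffDeriv (D : Derivation K R R) (G : PowerSeries R) : PowerSeries R :=
  PowerSeries.mk fun n => D (PowerSeries.coeff n G)

theorem coeffDeriv_mul (D : Derivation K R R) (G H : PowerSeries R) :
    coeffDeriv D (G * H) = coeffDeriv D G * H + G * coeffDeriv D H := by
  ext n
  simp only [coeffDeriv, PowerSeries.coeff_mk, PowerSeries.coeff_mul, map_add, map_sum,
    ← sum_add_distrib, Derivation.leibniz, smul_eq_mul]
  exact sum_congr rfl fun p _ => by ring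

theorem coeffDeriv_add (D : Derivation K R R) (G H : PowerSeries R) :
    coeffDeriv D (G + H) = coeffDeriv D G + coeffDeriv D H := by
  ext n; simp [coeffDeriv]

theorem euler_add (G H : PowerSeries R) : euler (G + H) = euler G + euler H := by
  ext n; rw [coeff_euler, map_add, map_add, coeff_euler, coeff_euler, mul_add]

/-- The chain rule for `y d/dy` of the translated polynomial. The sum over derivations is infinite,
but a given `v` involves finitely many variables, so any large enough truncation is exact. -/
theorem euler_shift (d : σ → ℕ+) (β : σ → K)
    (x : ℕ+ → Derivation K (MvPolynomial σ K) (MvPolynomial σ K))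
    (hx : ∀ k i, x k (MvPolynomial.X i) = if d i = k then MvPolynomial.C (β i) else 0)
    (v : MvPolynomial σ K) :
    ∀ᶠ N in Filter.atTop, euler (shift d β v : PowerSeries (MvPolynomial σ K)) =
      ∑ i ∈ range N, ((i + 1 : ℕ) : PowerSeries (MvPolynomial σ K)) *
        (PowerSeries.X ^ (i + 1) * coeffDeriv (x i.succPNat) (shift d β v)) := by
  induction v using MvPolynomial.induction_on with
  | C c =>
    refine Filter.Eventually.of_forall fun N => ?_
    have h1 : euler (shift d β (MvPolynomial.C c) : PowerSeries (MvPolynomial σ K)) = 0 := by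
      ext1 n
      rw [coeff_euler, shift_C, Polynomial.coeff_coe, Polynomial.coeff_C]
      split_ifs with h <;> simp [h]
    have h2 : ∀ D : Derivation K (MvPolynomial σ K) (MvPolynomial σ K),
        coeffDeriv D (shift d β (MvPolynomial.C c)) = 0 := by
      intro D
      ext1 n
      rw [coeffDeriv, PowerSeries.coeff_mk, shift_C, Polynomial.coeff_coe, Polynomial.coeff_C]
      split_ifs with h <;> simp
    simp only [h1, h2, mul_zero, sum_const_zero]
  | add u v hu hv =>
    filter_upwards [hu, hv] with N hu hv
    simp only [map_add, Polynomial.coe_add, euler_add, coeffDeriv_add, mul_add,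
      sum_add_distrib, hu, hv]
  | mul_X u i hu =>
    filter_upwards [hu, Filter.eventually_ge_atTop (d i : ℕ)] with N hu hN
    have h1 : euler (shift d β (MvPolynomial.X i) : PowerSeries (MvPolynomial σ K)) =
        ((d i : ℕ) : PowerSeries (MvPolynomial σ K)) *
          (PowerSeries.X ^ (d i : ℕ) * PowerSeries.C (MvPolynomial.C (β i))) := by
      ext1 n
      rw [coeff_euler, shift_X, Polynomial.coeff_coe, ← nsmul_eq_mul, ← nsmul_eq_mul, map_nsmul,
        mul_comm (_ ^ _), PowerSeries.coeff_C_mul, PowerSeries.coeff_X_pow, Polynomial.coeff_add,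
        Polynomial.coeff_C_mul, Polynomial.coeff_X_pow, Polynomial.coeff_C]
      have := (d i).pos
      split_ifs with h h' h'
      · omega
      · simp [h]
      · simp [h']
      · simp
    have h2 : ∀ k, coeffDeriv (x k) (shift d β (MvPolynomial.X i)) =
        if d i = k then PowerSeries.C (MvPolynomial.C (β i)) else 0 := by
      intro k
      ext1 n
      rw [coeffDeriv, PowerSeries.coeff_mk, shift_X, Polynomial.coeff_coe, Polynomial.coeff_add,
        Polynomial.coeff_C_mul, Polynomial.coeff_X_pow, Polynomial.coeff_C, map_add, mul_ite,
        mul_one, mul_zero, apply_ite (x k), apply_ite (x k), hx, map_zero,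
        ← MvPolynomial.algebraMap_eq, Derivation.map_algebraMap]
      split_ifs <;> simp_all [PowerSeries.coeff_C]
    have h3 : ∑ j ∈ range N, ((j + 1 : ℕ) : PowerSeries (MvPolynomial σ K)) *
        (PowerSeries.X ^ (j + 1) * coeffDeriv (x j.succPNat) (shift d β (MvPolynomial.X i))) =
        euler (shift d β (MvPolynomial.X i) : PowerSeries (MvPolynomial σ K)) := by
      rw [h1, sum_eq_single (d i).natPred]
      · rw [h2, PNat.succPNat_natPred, if_pos rfl, PNat.natPred_add_one]
      · intro j _ hj
        rw [h2, if_neg, mul_zero, mul_zero]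
        rintro h
        exact hj (by rw [h, Nat.natPred_succPNat])
      · intro h
        have := PNat.natPred_add_one (d i)
        simp at h
        omega
    rw [map_mul, Polynomial.coe_mul, euler_mul, hu, ← h3, sum_mul, mul_sum, ← sum_add_distrib]
    refine sum_congr rfl fun j _ => ?_
    rw [coeffDeriv_mul]
    ring

/-- Taylor's formula: both sides have the same constant coefficient and satisfy the same Euler
equation, which determines the coefficients recursively. -/
theorem coeff_expSeries_derivation [CharZero K] (d : σ → ℕ+) (β : σ → K)
    (x : ℕ+ → Derivation K (MvPolynomial σ K) (MvPolynomial σ K))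
    (hx : ∀ k i, x k (MvPolynomial.X i) = if d i = k then MvPolynomial.C (β i) else 0)
    (n : ℕ) (v : MvPolynomial σ K) :
    PowerSeries.coeff n (expSeries K fun k => ((x k : _ →ₗ[K] _) :
      Module.End K (MvPolynomial σ K))) v = (shift d β v).coeff n := by
  have hc : ∀ k l, Commute ((x k : _ →ₗ[K] _) : Module.End K (MvPolynomial σ K))
      ((x l : _ →ₗ[K] _) : Module.End K (MvPolynomial σ K)) := by
    intro k l
    have h : ⁅x k, x l⁆ = 0 := MvPolynomial.derivation_ext fun i => by
      rw [Derivation.commutator_apply, hx, hx, apply_ite (x k), apply_ite (x l),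
        ← MvPolynomial.algebraMap_eq, Derivation.map_algebraMap, Derivation.map_algebraMap]
      simp
    refine LinearMap.ext fun w => ?_
    have := congrArg (fun D => D w) h
    rw [Derivation.commutator_apply] at this
    exact sub_eq_zero.1 this
  induction n using Nat.strong_induction_on with
  | _ n ih =>
    rcases Nat.eq_zero_or_pos n with rfl | hn
    · rw [coeff_zero_expSeries, Module.End.one_apply]
      have h : ((Polynomial.aeval (0 : MvPolynomial σ K)).restrictScalars K).comp (shift d β) =
          AlgHom.id K _ := by
        refine MvPolynomial.algHom_ext fun i => ?_
        simp
      have := congrArg (fun f => f v) h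
      simpa [Polynomial.coeff_zero_eq_aeval_zero] using this.symm
    · obtain ⟨N, h1, hN⟩ := ((euler_shift d β x hx v).and
        (Filter.eventually_ge_atTop n)).exists
      have h2 := congrArg (fun F : PowerSeries (Module.End K (MvPolynomial σ K)) =>
        PowerSeries.coeff n F v) (euler_expSeries (K := K) hc)
      simp only [coeff_euler, PowerSeries.coeff_mul] at h2
      rw [Finset.Nat.sum_antidiagonal_eq_sum_range_succ_mk, sum_range_succ'] at h2
      have h3 := congrArg (PowerSeries.coeff n) h1
      rw [coeff_euler, Polynomial.coeff_coe, map_sum] at h3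
      have hn0 : (n : K) ≠ 0 := by exact_mod_cast hn.ne'
      refine smul_right_injective (MvPolynomial σ K) hn0 ?_
      have h4 : (n : K) • (shift d β v).coeff n = (n : MvPolynomial σ K) *
          (shift d β v).coeff n := by rw [Nat.cast_smul_eq_nsmul, nsmul_eq_mul]
      simp only at h4 ⊢
      rw [h4, h3]
      have h5 : (n : K) • (PowerSeries.coeff n (expSeries K fun k => ((x k : _ →ₗ[K] _) :
          Module.End K (MvPolynomial σ K)))) v = ((n : Module.End K (MvPolynomial σ K)) *
          PowerSeries.coeff n (expSeries K fun k => ((x k : _ →ₗ[K] _) :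
          Module.End K (MvPolynomial σ K)))) v := by
        rw [Nat.cast_smul_eq_nsmul, ← nsmul_eq_mul]; rfl
      rw [h5, h2, LinearMap.add_apply, LinearMap.sum_apply, Nat.cast_zero, zero_mul, zero_mul,
        LinearMap.zero_apply, add_zero, ← sum_subset (range_subset_range.2 hN)]
      · refine sum_congr rfl fun i hi => ?_
        have hi := mem_range.1 hi
        rw [← nsmul_eq_mul (α := PowerSeries _), map_nsmul, PowerSeries.coeff_X_pow_mul',
          if_pos (by omega), coeffDeriv, PowerSeries.coeff_mk, Polynomial.coeff_coe,
          ← ih (n - (i + 1)) (by omega)]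
        simp only
        rw [coeff_posSeries _ (Nat.succ_pos i), ← nsmul_eq_mul, smul_mul_assoc]
        rfl
      · intro i _ hi
        have hi : ¬ i < n := by simpa using hi
        rw [← nsmul_eq_mul, map_nsmul, PowerSeries.coeff_X_pow_mul', if_neg (by omega), smul_zero]

end Shift

/-! ### Coefficient extraction from products of series in `z` and polynomials in `z⁻¹`. -/

section Contract

variable {R : Type*} [CommRing R]

/-- The coefficients of a power series, indexed by integers. -/
def intCoeff (F : PowerSeries R) (m : ℤ) : R :=
  if 0 ≤ m then PowerSeries.coeff m.toNat F else 0

@[simp] theorem intCoeff_natCast (F : PowerSeries R) (n : ℕ) :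
    intCoeff F n = PowerSeries.coeff n F := by
  simp [intCoeff]

theorem intCoeff_of_neg (F : PowerSeries R) {m : ℤ} (h : m < 0) : intCoeff F m = 0 :=
  if_neg (by omega)

/-- The Cauchy product, with the window `[-N, N]` wide enough to contain every index with a nonzero
contribution. -/
theorem sum_intCoeff_mul_intCoeff (F G : PowerSeries R) (x y : ℤ) {N : ℕ}
    (hx : |x| ≤ N) (hy : |y| ≤ N) :
    ∑ b ∈ Icc (-(N : ℤ)) N, intCoeff F (x + b) * intCoeff G (y - b) = intCoeff (F * G) (x + y) := by
  have hx := abs_le.1 hx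
  have hy := abs_le.1 hy
  rcases lt_or_ge (x + y) 0 with h | h
  · rw [intCoeff_of_neg _ h]
    refine sum_eq_zero fun b _ => ?_
    rcases lt_or_ge (x + b) 0 with h' | h'
    · rw [intCoeff_of_neg _ h', zero_mul]
    · rw [intCoeff_of_neg G (by omega), mul_zero]
  · obtain ⟨n, hn⟩ := Int.eq_ofNat_of_zero_le h
    rw [hn, intCoeff_natCast, PowerSeries.coeff_mul]
    symm
    refine sum_of_injOn (fun p => (p.1 : ℤ) - x) ?_ ?_ ?_ ?_
    · intro p hp q hq hpq
      have hp := mem_antidiagonal.1 (mem_coe.1 hp)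
      have hq := mem_antidiagonal.1 (mem_coe.1 hq)
      simp only at hpq
      ext <;> omega
    · intro p hp
      have hp := mem_antidiagonal.1 (mem_coe.1 hp)
      simp only [coe_Icc, Set.mem_Icc]
      omega
    · intro b _ hb
      rcases lt_or_ge (x + b) 0 with h' | h'
      · rw [intCoeff_of_neg _ h', zero_mul]
      rcases lt_or_ge (y - b) 0 with h'' | h''
      · rw [intCoeff_of_neg G h'', mul_zero]
      · refine absurd ⟨((x + b).toNat, (y - b).toNat), ?_, ?_⟩ hb
        · rw [mem_coe, HasAntidiagonal.mem_antidiagonal]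
          simp only
          omega
        · simp only
          omega
    · intro p hp
      have hp := mem_antidiagonal.1 hp
      have h1 : x + ((p.1 : ℤ) - x) = (p.1 : ℤ) := by ring
      have h2 : y - ((p.1 : ℤ) - x) = (p.2 : ℤ) := by omega
      simp only [h1, h2, intCoeff_natCast]

/-- The linear map `∑_j u_j y^j ↦ ∑_j F_{l+j} u_j`, the coefficient extraction in the product of a
power series in `z` with a polynomial in `y = z⁻¹`. -/
def contract (F : PowerSeries R) (l : ℤ) : Polynomial R →ₗ[R] R :=
  Polynomial.lsum fun j => LinearMap.mulLeft R (intCoeff F (l + j))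

theorem contract_eq_sum (F : PowerSeries R) (l : ℤ) {p : Polynomial R} {N : ℕ}
    (hN : ∀ n, N ≤ n → p.coeff n = 0) :
    contract F l p = ∑ j ∈ range N, intCoeff F (l + j) * p.coeff j := by
  change p.sum (fun j u => intCoeff F (l + j) * u) = _
  refine Polynomial.sum_eq_of_subset _ (by simp) fun n hn => ?_
  rw [mem_range]
  by_contra h
  exact Polynomial.mem_support_iff.1 hn (hN n (by omega))

theorem contract_monomial (F : PowerSeries R) (l : ℤ) (n : ℕ) (u : R) :
    contract F l (Polynomial.monomial n u) = intCoeff F (l + n) * u := by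
  change (Polynomial.monomial n u).sum (fun j u => intCoeff F (l + j) * u) = _
  rw [Polynomial.sum_monomial_index _ _ (by simp)]

theorem contract_C_mul_X_pow_mul (F : PowerSeries R) (l : ℤ) (a : ℕ) (u : R) (p : Polynomial R) :
    contract F l (Polynomial.C u * Polynomial.X ^ a * p) = u * contract F (l + a) p := by
  induction p using Polynomial.induction_on' with
  | add p q hp hq => rw [mul_add, map_add, hp, hq, map_add, mul_add]
  | monomial n c =>
    rw [Polynomial.C_mul_X_pow_eq_monomial, Polynomial.monomial_mul_monomial, contract_monomial,
      contract_monomial]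
    push_cast
    rw [add_assoc]
    ring

theorem contract_map {R S : Type*} [CommRing R] [CommRing S] (f : R →+* S) (F : PowerSeries R)
    (l : ℤ) (p : Polynomial R) :
    f (contract F l p) = contract (PowerSeries.map f F) l (p.map f) := by
  induction p using Polynomial.induction_on' with
  | add p q hp hq => simp only [map_add, hp, hq, Polynomial.map_add]
  | monomial n u =>
    rw [contract_monomial, map_mul, Polynomial.map_monomial, contract_monomial]
    congr 1
    simp only [intCoeff, PowerSeries.coeff_map]
    split_ifs
    · rfl
    · exact map_zero f

theorem contract_mul_C {R : Type*} [CommRing R] (F : PowerSeries R) (l : ℤ) (p : Polynomial R)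
    (u : R) : contract F l (p * Polynomial.C u) = contract F l p * u := by
  rw [mul_comm, ← Polynomial.smul_eq_C_mul, map_smul, smul_eq_mul, mul_comm]

theorem coeff_coeff_bivariateSwap (p : Polynomial (Polynomial R)) (i j : ℕ) :
    ((Polynomial.Bivariate.swap p).coeff i).coeff j = (p.coeff j).coeff i := by
  induction p using Polynomial.induction_on' with
  | add p q hp hq => simp only [map_add, Polynomial.coeff_add, hp, hq]
  | monomial n f =>
    induction f using Polynomial.induction_on' with
    | add p q hp hq => simp only [map_add, Polynomial.coeff_add, hp, hq]
    | monomial m r =>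
      rw [Polynomial.Bivariate.swap_monomial_monomial]
      simp only [Polynomial.coeff_monomial]
      split_ifs <;> simp_all [Polynomial.coeff_monomial]

end Contract

/-! ### Translations of power sums and their action on exponentials. -/

section Vertex

/-- Polynomials in the power sums. -/
abbrev Sym (K : Type*) [Field K] : Type _ := MvPolynomial ℕ+ K

variable {K : Type*} [Field K]

/-- The translation `p_k ↦ p_k + c y^k`. -/
def pshift (c : K) : Sym K →ₐ[K] Polynomial (Sym K) := shift id fun _ => c

theorem pshift_X (c : K) (k : ℕ+) :
    pshift c (MvPolynomial.X k) = Polynomial.C (MvPolynomial.X k) +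
      Polynomial.C (MvPolynomial.C c) * Polynomial.X ^ (k : ℕ) := shift_X _ _ _

/-- Translations in two independent parameters commute; the bivariate swap only exchanges the names
of the parameters. -/
theorem pshift_coeff_comm (c c' : K) (v : Sym K) (i j : ℕ) :
    (pshift c ((pshift c' v).coeff i)).coeff j = (pshift c' ((pshift c v).coeff j)).coeff i := by
  have h : ((Polynomial.Bivariate.swap (R := Sym K)).toAlgHom.restrictScalars K).comp
      ((Polynomial.mapAlgHom (pshift c)).comp (pshift c')) =
      (Polynomial.mapAlgHom (pshift c')).comp (pshift c) := by
    refine MvPolynomial.algHom_ext fun k => ?_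
    simp [pshift, Polynomial.Bivariate.swap_apply]
    ring
  have h1 := congrArg (fun p => (p.coeff j).coeff i) (DFunLike.congr_fun h v)
  simp only [AlgHom.comp_apply] at h1
  have h2 := coeff_coeff_bivariateSwap (Polynomial.mapAlgHom (pshift c) (pshift c' v)) j i
  simp only [Polynomial.coe_mapAlgHom, Polynomial.coeff_map] at h1 h2
  exact h2.symm.trans h1

/-- Summing along antidiagonals sets the two parameters equal, and then the translations by `c` and
`-c` cancel. -/
theorem sum_pshift_coeff_pshift_coeff (c : K) (v : Sym K) (N : ℕ) :
    ∑ p ∈ antidiagonal N, (pshift (-c) ((pshift c v).coeff p.1)).coeff p.2 =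
      if N = 0 then v else 0 := by
  have h : (Polynomial.eval₂RingHom (pshift (-c) : Sym K →+* Polynomial (Sym K))
      Polynomial.X).comp (pshift c : Sym K →+* Polynomial (Sym K)) = Polynomial.C := by
    refine MvPolynomial.ringHom_ext (fun r => ?_) fun k => ?_
    · simp [pshift]
    · simp [pshift]
      ring
  have h1 : ∀ q : Polynomial (Sym K), (Polynomial.eval₂ (pshift (-c) : Sym K →+* _)
      Polynomial.X q).coeff N =
      ∑ p ∈ antidiagonal N, (pshift (-c) (q.coeff p.1)).coeff p.2 := by
    intro q
    induction q using Polynomial.induction_on' with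
    | add p q hp hq =>
      simp only [Polynomial.eval₂_add, Polynomial.coeff_add, map_add, sum_add_distrib, hp, hq]
    | monomial n u =>
      rw [Polynomial.eval₂_monomial, Polynomial.coeff_mul_X_pow']
      simp only [Polynomial.coeff_monomial, RingHom.coe_coe]
      split_ifs with hn
      · rw [sum_eq_single (n, N - n)]
        · simp
        · intro p hp hne
          have hp := mem_antidiagonal.1 hp
          rw [if_neg]
          · simp
          · rintro rfl
            exact hne (by ext <;> simp; omega)
        · intro h
          simp only [HasAntidiagonal.mem_antidiagonal] at h
          omega
      · symm
        refine sum_eq_zero fun p hp => ?_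
        have hp := mem_antidiagonal.1 hp
        rw [if_neg (by omega)]
        simp
  rw [← h1]
  have := congrArg (fun p => p.coeff N) (DFunLike.congr_fun h v)
  simp only [RingHom.comp_apply, Polynomial.coe_eval₂RingHom, RingHom.coe_coe,
    Polynomial.coeff_C] at this
  exact this

theorem exists_pshift_coeff_eq_zero (c : K) (v : Sym K) :
    ∃ M, ∀ n, M ≤ n → (pshift c v).coeff n = 0 :=
  ⟨(pshift c v).natDegree + 1, fun _ hn => Polynomial.coeff_eq_zero_of_natDegree_lt hn⟩

/-- `exp (∑ a_k p_k z^k)`. -/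
def pExp (a : ℕ+ → K) : PowerSeries (Sym K) :=
  expSeries K fun k => a k • (MvPolynomial.X k : Sym K)

theorem pExp_mul [CharZero K] (a b : ℕ+ → K) : pExp a * pExp b = pExp fun k => a k + b k := by
  simp only [pExp, ← expSeries_add, add_smul]

theorem pshift_coeff_pExp [CharZero K] (a : ℕ+ → K) (c : K) (n : ℕ) :
    pshift c (PowerSeries.coeff n (pExp a)) = ∑ p ∈ antidiagonal n,
      Polynomial.C (PowerSeries.coeff p.1 (pExp a)) * PowerSeries.coeff p.2
        (expSeries K fun k => (a k * c) • (Polynomial.X : Polynomial (Sym K)) ^ (k : ℕ)) := by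
  have h1 := congrArg (PowerSeries.coeff n) (map_expSeries (pshift c)
    fun k => a k • (MvPolynomial.X k : Sym K))
  have h2 := fun m => congrArg (PowerSeries.coeff m) (map_expSeries
    (Polynomial.CAlgHom : Sym K →ₐ[K] Polynomial (Sym K))
    fun k => a k • (MvPolynomial.X k : Sym K))
  simp only [PowerSeries.coeff_map, RingHom.coe_coe, Polynomial.CAlgHom_apply] at h1 h2
  rw [pExp, h1]
  simp only [h2, ← PowerSeries.coeff_mul, ← expSeries_add]
  congr 3
  funext k
  rw [map_smul, pshift_X, smul_add, ← Polynomial.smul_C, mul_smul]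
  congr 2
  rw [Algebra.smul_def]
  rfl

end Vertex

/-! ### Vertex operators, normal ordering and the exchange relation. -/

section Vertex

variable {K : Type*} [Field K]

/-- The exponent `c ∑ (1 - s^k)/k p_k z^k` of the creation half of a vertex operator. -/
def qSeries (s c : K) : PowerSeries (Sym K) :=
  pExp fun k => c * ((1 - s ^ (k : ℕ)) / ((k : ℕ) : K))

/-- The coefficient of `z^l` in
`exp (c ∑ (1 - s^k)/k p_k z^k) exp (-c ∑ z^{-k} ∂/∂p_k)`. -/
def vertex (s c : K) (l : ℤ) : Sym K →ₗ[K] Sym K :=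
  ((contract (qSeries s c) l).restrictScalars K).comp (pshift (-c)).toLinearMap

theorem vertex_apply (s c : K) (l : ℤ) (v : Sym K) :
    vertex s c l v = contract (qSeries s c) l (pshift (-c) v) := rfl

/-- The coefficient of `z^l w^m` in the normally ordered product of the vertex operators with
parameters `c` and `-c`. -/
def normalOrdered (s c : K) (M : ℕ) (l m : ℤ) (v : Sym K) : Sym K :=
  ∑ j ∈ range M, ∑ n ∈ range M, intCoeff (qSeries s c) (l + j) *
    (intCoeff (qSeries s (-c)) (m + n) * (pshift c ((pshift (-c) v).coeff j)).coeff n)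

theorem normalOrdered_swap (s c : K) (M : ℕ) (l m : ℤ) (v : Sym K) :
    normalOrdered s (-c) M m l v = normalOrdered s c M l m v := by
  rw [normalOrdered, sum_comm, normalOrdered]
  refine sum_congr rfl fun j _ => sum_congr rfl fun n _ => ?_
  rw [neg_neg, pshift_coeff_comm]
  ring

variable [CharZero K]

/-- For opposite charges with `c² = 1` the exponents multiply to `+(1 - s^k)/k`, so the contraction
factor is `(1 - s x)/(1 - x)` itself and not its inverse. -/
theorem pshift_coeff_qSeries (s : K) {c : K} (hc : c * c = 1) (r : ℕ) :
    pshift (-c) (PowerSeries.coeff r (qSeries s (-c))) = ∑ p ∈ antidiagonal r,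
      Polynomial.C (gcoef s p.2 • PowerSeries.coeff p.1 (qSeries s (-c))) *
        Polynomial.X ^ p.2 := by
  have h : (fun k : ℕ+ => (-c * ((1 - s ^ (k : ℕ)) / ((k : ℕ) : K)) * -c) •
      (Polynomial.X : Polynomial (Sym K)) ^ (k : ℕ)) = fun k : ℕ+ =>
      ((1 - s ^ (k : ℕ)) / ((k : ℕ) : K)) • Polynomial.X ^ (k : ℕ) := by
    funext k
    congr 1
    linear_combination ((1 - s ^ (k : ℕ)) / ((k : ℕ) : K)) * hc
  rw [qSeries, pshift_coeff_pExp, h, expSeries_one_sub_pow_div]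
  refine sum_congr rfl fun p _ => ?_
  rw [PowerSeries.coeff_mk, ← Polynomial.smul_C, mul_smul_comm, smul_mul_assoc]

theorem vertex_coeff_qSeries_mul (s : K) {c : K} (hc : c * c = 1) (l r : ℤ) (u : Sym K) {N : ℕ}
    (hN : r < N) :
    vertex s c l (intCoeff (qSeries s (-c)) r * u) = ∑ a ∈ range N,
      gcoef s a • (intCoeff (qSeries s (-c)) (r - a) * vertex s c (l + a) u) := by
  rcases lt_or_ge r 0 with hr | hr
  · rw [intCoeff_of_neg _ hr, zero_mul, map_zero]
    refine (sum_eq_zero fun a _ => ?_).symm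
    rw [intCoeff_of_neg _ (by omega), zero_mul, smul_zero]
  obtain ⟨n, rfl⟩ := Int.eq_ofNat_of_zero_le hr
  rw [vertex_apply, map_mul, intCoeff_natCast, pshift_coeff_qSeries s hc, sum_mul, map_sum]
  simp only [contract_C_mul_X_pow_mul, smul_mul_assoc, ← vertex_apply]
  rw [← Finset.Nat.sum_antidiagonal_swap, Finset.Nat.sum_antidiagonal_eq_sum_range_succ_mk,
    ← sum_subset (range_subset_range.2 (by omega : n + 1 ≤ N))]
  · refine sum_congr rfl fun a ha => ?_
    have ha := mem_range.1 ha
    have : ((n : ℤ) - a) = ((n - a : ℕ) : ℤ) := by omega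
    simp only [Prod.swap, this, intCoeff_natCast]
  · intro a _ ha
    have ha : ¬ a < n + 1 := by simpa using ha
    rw [intCoeff_of_neg _ (by omega), zero_mul, smul_zero]

/-- Moving the annihilation half of the outer operator past the creation half of the inner one costs
the factor with coefficients `gcoef`. Terms with `a ≥ N` vanish, as they need a negative mode of the
inner creation series. -/
theorem vertex_vertex (s : K) {c : K} (hc : c * c = 1) (l m : ℤ) (v : Sym K) {M N : ℕ}
    (hM : ∀ n, M ≤ n → (pshift (-c) v).coeff n = 0)
    (hM' : ∀ n, M ≤ n → (pshift c v).coeff n = 0) (hN : l + M ≤ N) :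
    vertex s (-c) m (vertex s c l v) = ∑ a ∈ range N,
      gcoef s a • normalOrdered s c M (l - a) (m + a) v := by
  rw [vertex_apply s c, contract_eq_sum _ _ hM, map_sum]
  have h1 : ∀ j ∈ range M, vertex s (-c) m (intCoeff (qSeries s c) (l + j) *
      (pshift (-c) v).coeff j) = ∑ a ∈ range N, gcoef s a •
        (∑ n ∈ range M, intCoeff (qSeries s c) (l - a + j) *
    (intCoeff (qSeries s (-c)) (m + a + n) * (pshift c ((pshift (-c) v).coeff j)).coeff n)) := by
    intro j hj
    have hj := mem_range.1 hj
    have h2 := vertex_coeff_qSeries_mul s (c := -c) (by simpa using hc) m (l + j)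
      ((pshift (-c) v).coeff j) (N := N) (by omega)
    rw [neg_neg] at h2
    rw [h2]
    refine sum_congr rfl fun a _ => ?_
    rw [vertex_apply, neg_neg, contract_eq_sum (N := M), mul_sum]
    · congr 1
      refine sum_congr rfl fun n _ => ?_
      rw [show l + j - a = l - a + (j : ℤ) by ring]
    · intro n hn
      rw [pshift_coeff_comm, hM' n hn, map_zero, Polynomial.coeff_zero]
  rw [sum_congr rfl h1, sum_comm]
  simp only [normalOrdered, smul_sum]

theorem qSeries_mul_neg (s c : K) : qSeries s c * qSeries s (-c) = 1 := by
  have : (1 : PowerSeries (Sym K)) = expSeries K fun _ => 0 := expSeries_zero.symm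
  rw [qSeries, qSeries, pExp_mul, this, pExp]
  congr 1
  funext k
  rw [neg_mul, add_neg_cancel, zero_smul]

/-- The sum over `b` sets both spectral parameters equal. There the creation halves of opposite
charge multiply to `1` and the translations cancel, leaving the identity in total degree zero. -/
theorem sum_normalOrdered (s c : K) (l m : ℤ) (v : Sym K) {M N : ℕ}
    (hM : ∀ n, M ≤ n → (pshift (-c) v).coeff n = 0)
    (hM' : ∀ n, M ≤ n → (pshift c v).coeff n = 0) (hl : |l| + M ≤ N) (hm : |m| + M ≤ N) :
    ∑ b ∈ Icc (-(N : ℤ)) N, normalOrdered s c M (l + b) (m - b) v =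
      if l + m = 0 then v else 0 := by
  have h1 : ∀ j ∈ range M, ∀ n ∈ range M, ∑ b ∈ Icc (-(N : ℤ)) N,
      intCoeff (qSeries s c) (l + b + j) * (intCoeff (qSeries s (-c)) (m - b + n) *
        (pshift c ((pshift (-c) v).coeff j)).coeff n) =
      if l + m + (j + n : ℕ) = 0 then (pshift c ((pshift (-c) v).coeff j)).coeff n else 0 := by
    intro j hj n hn
    have hj := mem_range.1 hj
    have hn := mem_range.1 hn
    simp only [← mul_assoc, ← sum_mul]
    have h2 := sum_intCoeff_mul_intCoeff (qSeries s c) (qSeries s (-c)) (l + j) (m + n) (N := N)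
      (by have := abs_add_le l j; rw [Nat.abs_cast] at this; omega)
      (by have := abs_add_le m n; rw [Nat.abs_cast] at this; omega)
    have h3 : ∀ b : ℤ, l + b + j = l + j + b := fun b => by ring
    have h4 : ∀ b : ℤ, m - b + n = m + n - b := fun b => by ring
    simp only [h3, h4, h2, qSeries_mul_neg]
    rw [show l + j + (m + n) = l + m + (j + n : ℕ) by push_cast; ring]
    split_ifs with h
    · rw [h]; simp [intCoeff]
    · rcases lt_or_ge (l + m + (j + n : ℕ)) 0 with h' | h'
      · rw [intCoeff_of_neg _ h', zero_mul]
      · obtain ⟨k, hk⟩ := Int.eq_ofNat_of_zero_le h'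
        rw [hk, intCoeff_natCast, PowerSeries.coeff_one, if_neg (by omega), zero_mul]
  simp only [normalOrdered]
  rw [sum_comm]
  have h2 : ∀ j ∈ range M, ∑ b ∈ Icc (-(N : ℤ)) N, ∑ n ∈ range M,
      intCoeff (qSeries s c) (l + b + j) * (intCoeff (qSeries s (-c)) (m - b + n) *
        (pshift c ((pshift (-c) v).coeff j)).coeff n) = ∑ n ∈ range M,
      if l + m + (j + n : ℕ) = 0 then (pshift c ((pshift (-c) v).coeff j)).coeff n else 0 := by
    intro j hj
    rw [sum_comm]
    exact sum_congr rfl (h1 j hj)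
  rw [sum_congr rfl h2, ← sum_product']
  rcases lt_or_ge 0 (l + m) with h | h
  · rw [if_neg h.ne']
    exact sum_eq_zero fun p _ => if_neg (by omega)
  · obtain ⟨k, hk⟩ := Int.eq_ofNat_of_zero_le (neg_nonneg.2 h)
    have h3 := sum_pshift_coeff_pshift_coeff (-c) v k
    rw [neg_neg] at h3
    have h4 : (l + m = 0) ↔ k = 0 := by omega
    simp only [h4, ← h3]
    rw [← sum_filter]
    refine sum_subset_zero_on_sdiff ?_ ?_ fun _ _ => rfl
    · intro p hp
      have := (mem_filter.1 hp).2
      rw [HasAntidiagonal.mem_antidiagonal]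
      omega
    · intro p hp
      rw [mem_sdiff, HasAntidiagonal.mem_antidiagonal, mem_filter, mem_product, mem_range,
        mem_range] at hp
      have : M ≤ p.1 ∨ M ≤ p.2 := by omega
      rcases this with h | h
      · rw [hM _ h, map_zero, Polynomial.coeff_zero]
      · rw [pshift_coeff_comm, hM' _ h, map_zero, Polynomial.coeff_zero]

/-- The exchange relation between the two families of vertex operators, in the form needed when
the terms of lower normal order are annihilated by `ω`. -/
theorem vertex_exchange (s : K) {E : Type*} [AddCommGroup E] [Module K E] (ω : Sym K →ₗ[K] E)
    (v : Sym K) (l m : ℤ)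
    (h : ∀ a : ℕ, 0 < a → ω (vertex s 1 (l + a) (vertex s (-1) (m - a) v)) = 0) :
    ω (vertex s (-1) m (vertex s 1 l v)) =
      (if l + m = 0 then (1 - s) • ω v else 0) + s • ω (vertex s 1 l (vertex s (-1) m v)) := by
  obtain ⟨M₁, hM₁⟩ := exists_pshift_coeff_eq_zero (-1) v
  obtain ⟨M₂, hM₂⟩ := exists_pshift_coeff_eq_zero 1 v
  set M := max M₁ M₂ with hM
  have h1 : ∀ n, M ≤ n → (pshift (-1) v).coeff n = 0 := fun n hn => hM₁ n (by omega)
  have h2 : ∀ n, M ≤ n → (pshift 1 v).coeff n = 0 := fun n hn => hM₂ n (by omega)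
  set N : ℕ := l.natAbs + m.natAbs + M + 1 with hN
  -- Both orders of the product expand in the same normally ordered terms `w b`: one order goes
  -- through `b ≤ 0`, the other upwards from its own index.
  set w : ℤ → E := fun b => ω (normalOrdered s 1 M (l + b) (m - b) v) with hw
  have hlow : ω (vertex s (-1) m (vertex s 1 l v)) =
      ∑ a ∈ range (N + 1), gcoef s a • w (-a) := by
    rw [vertex_vertex s (one_mul 1) l m v (N := N + 1) h1 h2 (by omega), map_sum]
    simp only [map_smul, hw, sub_neg_eq_add, ← sub_eq_add_neg]
  have hhigh : ∀ c : ℕ, ω (vertex s 1 (l + c) (vertex s (-1) (m - c) v)) =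
      ∑ a ∈ range (N + 1), gcoef s a • w (c + a) := by
    intro c
    have := vertex_vertex s (c := (-1 : K)) (by ring) (m - c) (l + c) v (M := M) (N := N + 1)
      (by simpa using h2) h1 (by omega)
    rw [neg_neg] at this
    rw [this, map_sum]
    refine sum_congr rfl fun a _ => ?_
    rw [map_smul, normalOrdered_swap]
    simp only [hw]
    rw [add_assoc, sub_sub]
  have htot : ∑ b ∈ Icc (-(N : ℤ)) N, w b = if l + m = 0 then ω v else 0 := by
    rw [← map_sum, sum_normalOrdered s 1 l m v h1 h2 (by rw [Int.abs_eq_natAbs]; omega)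
      (by rw [Int.abs_eq_natAbs]; omega)]
    split_ifs <;> simp
  have hvan : ∀ b : ℕ, N < b → w b = 0 := by
    intro b hb
    simp only [hw, normalOrdered]
    rw [sum_eq_zero, map_zero]
    intro j _
    refine sum_eq_zero fun n hn => ?_
    have hn := mem_range.1 hn
    rw [intCoeff_of_neg (qSeries s (-1)) (by omega), zero_mul, mul_zero]
  -- Downward induction on `b`: the hypothesis at `a = b` reads `w b + (1 - s) (w (b+1) + ⋯) = 0`,
  -- and the tail already vanishes.
  have hzero : ∀ d b : ℕ, 0 < b → N < b + d → w b = 0 := by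
    intro d
    induction d with
    | zero => exact fun b _ hb => hvan b hb
    | succ d ih =>
      intro b hb0 hb
      have h3 := hhigh b
      rw [h b hb0, sum_range_succ', sum_eq_zero] at h3
      · simpa [gcoef] using h3.symm
      · intro a _
        have := ih (b + (a + 1)) (by omega) (by omega)
        push_cast at this ⊢
        rw [this, smul_zero]
  have hpos : ∀ b : ℕ, 0 < b → w b = 0 := fun b hb => hzero (N + 1) b hb (by omega)
  have hw0 : ω (vertex s 1 l (vertex s (-1) m v)) = w 0 := by
    have h3 := hhigh 0
    rw [sum_range_succ', sum_eq_zero] at h3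
    · simpa [gcoef] using h3
    · intro a _
      have := hpos (a + 1) (by omega)
      push_cast at this ⊢
      rw [zero_add, this, smul_zero]
  have hneg : ∑ a ∈ range (N + 1), w (-a) = if l + m = 0 then ω v else 0 := by
    rw [← htot]
    refine sum_of_injOn (fun a => -(a : ℤ)) ?_ ?_ ?_ fun _ _ => rfl
    · intro a _ b _ hab
      simpa using hab
    · intro a ha
      have ha := mem_range.1 (mem_coe.1 ha)
      simp only [coe_Icc, Set.mem_Icc]
      omega
    · intro b hb hb'
      have hb := mem_Icc.1 hb
      rcases lt_or_ge 0 b with h' | h'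
      · obtain ⟨k, rfl⟩ := Int.eq_ofNat_of_zero_le h'.le
        exact hpos k (by omega)
      · refine absurd ⟨(-b).toNat, ?_, ?_⟩ hb'
        · rw [mem_coe, mem_range]; omega
        · simp only; omega
  rw [hlow, hw0]
  -- Writing `1 = (1 - s) + s` for the leading coefficient makes the weights constant, so the full
  -- sum `hneg` can be used.
  have h4 : ∀ a ∈ range (N + 1), gcoef s a • w (-a) =
      (1 - s) • w (-a) + if a = 0 then s • w 0 else 0 := by
    intro a _
    by_cases ha : a = 0
    · simp [ha, gcoef, sub_smul]
    · simp [ha, gcoef]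
  rw [sum_congr rfl h4, sum_add_distrib, ← smul_sum, hneg, sum_ite_eq']
  simp

end Vertex

/-! ### Hall–Littlewood functions and their orthogonality. -/

section Orthogonality

variable {K : Type*} [Field K]

/-- The constant term. -/
def eps : Sym K →ₐ[K] K := MvPolynomial.aeval fun _ => 0

/-- The Hall–Littlewood function `Q_L`, created from `1` by the vertex operators. -/
def qFun (s : K) (L : List ℕ) : Sym K := L.foldr (fun (k : ℕ) w => vertex s 1 k w) 1

/-- The functional dual to `Q_L`. -/
def dualFun (s : K) : List ℕ → Sym K →ₗ[K] K
  | [] => eps.toLinearMap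
  | k :: L => (dualFun s L).comp (vertex s (-1) (-k))

/-- `∏_i ∏_{k = 1}^{m_i} (1 - s^k)`, where `m_i` is the multiplicity of `i` in the list. -/
def bList (s : K) : List ℕ → K
  | [] => 1
  | k :: L => (1 - s ^ ((k :: L).count k)) * bList s L

@[simp] theorem qFun_nil (s : K) : qFun s [] = 1 := rfl

@[simp] theorem qFun_cons (s : K) (k : ℕ) (L : List ℕ) :
    qFun s (k :: L) = vertex s 1 k (qFun s L) := rfl

@[simp] theorem dualFun_nil (s : K) (v : Sym K) : dualFun s [] v = eps v := rfl

@[simp] theorem dualFun_cons (s : K) (k : ℕ) (L : List ℕ) (v : Sym K) :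
    dualFun s (k :: L) v = dualFun s L (vertex s (-1) (-k) v) := rfl

theorem vertex_one (s c : K) (l : ℤ) : vertex s c l 1 = intCoeff (qSeries s c) l := by
  have := contract_monomial (qSeries s c) l 0 1
  rw [vertex_apply, map_one, ← Polynomial.monomial_zero_one, this]
  simp

theorem vertex_neg_one_eq_zero (s c : K) {k : ℕ} (hk : 0 < k) : vertex s c (-k) 1 = 0 := by
  rw [vertex_one, intCoeff_of_neg _ (by omega)]

theorem map_coeff_pExp {R : Type*} [CommRing R] [Algebra K R] (f : Sym K →ₐ[K] R) (a : ℕ+ → K)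
    (n : ℕ) : f (PowerSeries.coeff n (pExp a)) =
      PowerSeries.coeff n (expSeries K fun k => a k • f (MvPolynomial.X k)) := by
  have := congrArg (PowerSeries.coeff n) (map_expSeries f
    fun k => a k • (MvPolynomial.X k : Sym K))
  simpa only [pExp, PowerSeries.coeff_map, RingHom.coe_coe, map_smul] using this

variable [CharZero K]

theorem eps_vertex (s c : K) {l : ℤ} (hl : 0 < l) (v : Sym K) : eps (vertex s c l v) = 0 := by
  obtain ⟨M, hM⟩ := exists_pshift_coeff_eq_zero (-c) v
  rw [vertex_apply, contract_eq_sum _ _ hM, map_sum]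
  refine sum_eq_zero fun j _ => ?_
  obtain ⟨n, hn⟩ := Int.eq_ofNat_of_zero_le (by omega : 0 ≤ l + j)
  rw [hn, intCoeff_natCast, map_mul, qSeries, map_coeff_pExp]
  simp only [eps, MvPolynomial.aeval_X, smul_zero, expSeries_zero]
  rw [PowerSeries.coeff_one, if_neg (by omega), zero_mul]

/-- The exchange relation carries the lowering operator through the raising ones down to the vacuum.
Its hypothesis holds by induction because larger lowering modes also exceed all parts, and `x < k`
excludes the delta term. -/
theorem vertex_qFun_eq_zero (s : K) (L : List ℕ) {k : ℕ} (hk : 0 < k) (hL : ∀ x ∈ L, x < k) :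
    vertex s (-1) (-k) (qFun s L) = 0 := by
  induction L generalizing k with
  | nil => exact vertex_neg_one_eq_zero s _ hk
  | cons x L ih =>
    have hx := hL x (by simp)
    have h := vertex_exchange s LinearMap.id (qFun s L) x (-k) fun a _ => by
      have := ih (k := k + a) (by omega) fun y hy => by
        have := hL y (by simp [hy]); omega
      rw [LinearMap.id_apply, show (-(k : ℤ) - a) = -((k + a : ℕ) : ℤ) by push_cast; ring, this,
        map_zero]
    rw [if_neg (by omega), ih hk fun y hy => hL y (by simp [hy])] at h
    simpa using h

/-- The dual statement: a raising mode above all parts moves left through the lowering modes until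
`eps` kills it. This is why `vertex_exchange` allows an arbitrary `ω`. -/
theorem dualFun_vertex_eq_zero (s : K) (L : List ℕ) {k : ℕ} (hk : 0 < k) (hL : ∀ x ∈ L, x < k)
    (v : Sym K) : dualFun s L (vertex s 1 k v) = 0 := by
  induction L generalizing k v with
  | nil => exact eps_vertex s 1 (by omega) v
  | cons x L ih =>
    have hx := hL x (by simp)
    have h := vertex_exchange s (dualFun s L) v k (-x) fun a _ => by
      have := ih (k := k + a) (by omega) (fun y hy => by
        have := hL y (by simp [hy]); omega) (vertex s (-1) (-x - a) v)
      rwa [Nat.cast_add] at this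
    rw [if_neg (by omega), ih hk fun y hy => hL y (by simp [hy])] at h
    simpa using h

/-- Each copy of `r` at the head of `L` gives one further exchange, and the scalars telescope by `(1
- s) + s (1 - s^m) = 1 - s^(m+1)`. -/
theorem vertex_vertex_qFun (s : K) (L : List ℕ) {r : ℕ} (hr : 0 < r) (hL : ∀ x ∈ L, x ≤ r)
    (hs : L.Pairwise (· ≥ ·)) :
    vertex s (-1) (-r) (vertex s 1 r (qFun s L)) = (1 - s ^ (L.count r + 1)) • qFun s L := by
  have h := vertex_exchange s LinearMap.id (qFun s L) r (-r) fun a ha => by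
    rw [LinearMap.id_apply, show (-(r : ℤ) - a) = -((r + a : ℕ) : ℤ) by push_cast; ring,
      vertex_qFun_eq_zero s L (by omega) fun y hy => by have := hL y hy; omega, map_zero]
  rw [if_pos (by omega)] at h
  simp only [LinearMap.id_apply] at h
  rw [h]
  induction L with
  | nil =>
    rw [qFun_nil, vertex_neg_one_eq_zero s _ hr]
    simp
  | cons x L ih =>
    rw [List.pairwise_cons] at hs
    rcases (hL x (by simp)).lt_or_eq with hx | rfl
    · have hlt : ∀ y ∈ x :: L, y < r := by
        intro y hy
        rcases List.mem_cons.1 hy with rfl | hy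
        · exact hx
        · have := hs.1 y hy; omega
      rw [vertex_qFun_eq_zero s _ hr hlt, List.count_eq_zero.2 fun hmem => (hlt r hmem).ne rfl]
      simp
    · have hL' : ∀ y ∈ L, y ≤ x := fun y hy => hL y (by simp [hy])
      have h' := vertex_exchange s LinearMap.id (qFun s L) x (-x) fun a ha => by
        rw [LinearMap.id_apply, show (-(x : ℤ) - a) = -((x + a : ℕ) : ℤ) by push_cast; ring,
          vertex_qFun_eq_zero s L (by omega) fun y hy => by have := hL' y hy; omega, map_zero]
      rw [if_pos (by omega)] at h'
      simp only [LinearMap.id_apply] at h'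
      have := ih hL' hs.2 h'
      rw [qFun_cons, h', this, List.count_cons_self, map_smul, smul_smul, ← add_smul]
      congr 1
      ring

/-- The functions `Q_L` are orthogonal. -/
theorem dualFun_qFun (s : K) (L L' : List ℕ) (hL : L.Pairwise (· ≥ ·)) (hL' : L'.Pairwise (· ≥ ·))
    (h0 : ∀ x ∈ L, 0 < x) (h0' : ∀ x ∈ L', 0 < x) :
    dualFun s L (qFun s L') = if L = L' then bList s L else 0 := by
  induction L generalizing L' with
  | nil =>
    cases L' with
    | nil => simp [bList]
    | cons x L' =>
      rw [if_neg (by simp), dualFun_nil, qFun_cons, eps_vertex]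
      exact_mod_cast h0' x (by simp)
  | cons k L ih =>
    have hk := h0 k (by simp)
    rw [dualFun_cons]
    cases L' with
    | nil => rw [if_neg (by simp), qFun_nil, vertex_neg_one_eq_zero s _ hk, map_zero]
    | cons x L' =>
      rw [List.pairwise_cons] at hL hL'
      have hx := h0' x (by simp)
      -- Only the largest parts are compared: the smaller raising part is killed by the lowering
      -- mode, the larger one by the functional, and equal parts peel off.
      rcases lt_trichotomy x k with h | rfl | h
      · rw [vertex_qFun_eq_zero s _ hk, map_zero, if_neg]
        · rintro ⟨⟩; omega
        · intro y hy
          rcases List.mem_cons.1 hy with rfl | hy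
          · exact h
          · have := hL'.1 y hy; omega
      · rw [qFun_cons, vertex_vertex_qFun s L' hx hL'.1 hL'.2, map_smul,
          ih L' hL.2 hL'.2 (fun y hy => h0 y (by simp [hy])) fun y hy => h0' y (by simp [hy])]
        by_cases h : L = L'
        · simp [h, bList, List.count_cons_self]
        · simp [h]
      · have := dualFun_vertex_eq_zero s (k :: L) hx (fun y hy => by
          rcases List.mem_cons.1 hy with rfl | hy
          · exact h
          · have := hL.1 y hy; omega) (qFun s L')
        rw [if_neg (by rintro ⟨⟩; omega), qFun_cons, ← dualFun_cons, this]

end Orthogonality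

/-! ### The grading, detected by the scalings `p_k ↦ c^k p_k`. -/

section Grading

variable {K : Type*} [Field K]

/-- The scaling `p_k ↦ c^k p_k`. -/
def scale (c : K) : Sym K →ₐ[K] Sym K :=
  MvPolynomial.aeval fun k => (c ^ (k : ℕ)) • MvPolynomial.X k

theorem scale_X (c : K) (k : ℕ+) : scale c (MvPolynomial.X k) = (c ^ (k : ℕ)) • MvPolynomial.X k :=
  MvPolynomial.aeval_X _ _

theorem pshift_scale_coeff (c e : K) (v : Sym K) (j : ℕ) :
    (pshift e (scale c v)).coeff j = c ^ j • scale c ((pshift e v).coeff j) := by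
  have h : (pshift e : Sym K →+* _).comp (scale c : Sym K →+* _) =
      (Polynomial.compRingHom (Polynomial.C (MvPolynomial.C c) * Polynomial.X)).comp
        ((Polynomial.mapRingHom (scale c : Sym K →+* Sym K)).comp (pshift e : Sym K →+* _)) := by
    refine MvPolynomial.ringHom_ext (fun r => ?_) fun k => ?_
    · simp [pshift, scale]
    · simp [pshift, scale, MvPolynomial.smul_eq_C_mul, mul_pow]
      ring
  have := congrArg (fun p => p.coeff j) (DFunLike.congr_fun h v)
  simp only [RingHom.comp_apply, RingHom.coe_coe, Polynomial.coe_compRingHom,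
    Polynomial.comp_C_mul_X_coeff, Polynomial.coe_mapRingHom, Polynomial.coeff_map] at this
  rw [this, MvPolynomial.smul_eq_C_mul, ← map_pow, mul_comm]

theorem coeff_scale (c : K) (v : Sym K) (m : ℕ+ →₀ ℕ) :
    MvPolynomial.coeff m (scale c v) = c ^ (m.sum fun k e => e * (k : ℕ)) *
      MvPolynomial.coeff m v := by
  classical
  induction v using MvPolynomial.induction_on' with
  | add p q hp hq => rw [map_add, MvPolynomial.coeff_add, hp, hq, MvPolynomial.coeff_add, mul_add]
  | monomial m' a =>
    have h : scale c (MvPolynomial.monomial m' a) =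
        c ^ (m'.sum fun k e => e * (k : ℕ)) • MvPolynomial.monomial m' a := by
      rw [scale, MvPolynomial.aeval_monomial, MvPolynomial.monomial_eq]
      simp only [smul_pow, Finsupp.prod, prod_smul, Finsupp.sum, ← prod_pow_eq_pow_sum]
      rw [mul_smul_comm]
      congr 1
      exact prod_congr rfl fun k _ => by rw [← pow_mul, mul_comm]
    rw [h, MvPolynomial.coeff_smul, smul_eq_mul, MvPolynomial.coeff_monomial]
    split_ifs with h'
    · rw [h']
    · simp

variable [CharZero K]

theorem expSeries_smul_pow {R : Type*} [CommRing R] [Algebra K R] (c : K) (x : ℕ+ → R) (n : ℕ) :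
    PowerSeries.coeff n (expSeries K fun k => c ^ (k : ℕ) • x k) =
      c ^ n • PowerSeries.coeff n (expSeries K x) := by
  have h : expSeries K (fun k => c ^ (k : ℕ) • x k) =
      PowerSeries.rescale (algebraMap K R c) (expSeries K x) := by
    refine expSeries_eq ?_ (by simp)
    have h1 : ∀ F : PowerSeries R, euler (PowerSeries.rescale (algebraMap K R c) F) =
        PowerSeries.rescale (algebraMap K R c) (euler F) := by
      intro F
      ext m
      rw [coeff_euler, PowerSeries.coeff_rescale, PowerSeries.coeff_rescale, coeff_euler]
      ring
    have h2 : posSeries (fun k => c ^ (k : ℕ) • x k) =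
        PowerSeries.rescale (algebraMap K R c) (posSeries x) := by
      ext m
      rw [PowerSeries.coeff_rescale]
      rcases Nat.eq_zero_or_pos m with rfl | hm
      · rw [coeff_zero_posSeries, coeff_zero_posSeries, mul_zero]
      · rw [coeff_posSeries _ hm, coeff_posSeries _ hm, ← map_pow, ← Algebra.smul_def]
        rfl
    rw [h1, euler_expSeries fun k l => Commute.all (x k) (x l), map_mul, h2, h1]
  rw [h, PowerSeries.coeff_rescale, ← map_pow, ← Algebra.smul_def]

theorem scale_coeff_pExp (c : K) (a : ℕ+ → K) (n : ℕ) :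
    scale c (PowerSeries.coeff n (pExp a)) = c ^ n • PowerSeries.coeff n (pExp a) := by
  rw [map_coeff_pExp, pExp, ← expSeries_smul_pow]
  simp only [scale_X, smul_comm (a _)]

theorem scale_vertex {c : K} (hc : c ≠ 0) (s e : K) (l : ℤ) (v : Sym K) :
    scale c (vertex s e l v) = c ^ l • vertex s e l (scale c v) := by
  obtain ⟨M, hM⟩ := exists_pshift_coeff_eq_zero (-e) v
  rw [vertex_apply, contract_eq_sum _ _ hM, vertex_apply, contract_eq_sum (N := M), map_sum,
    smul_sum]
  · refine sum_congr rfl fun j _ => ?_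
    rw [map_mul, pshift_scale_coeff]
    rcases lt_or_ge (l + j) 0 with h | h
    · simp [intCoeff_of_neg _ h]
    · obtain ⟨n, hn⟩ := Int.eq_ofNat_of_zero_le h
      rw [hn, intCoeff_natCast, qSeries, scale_coeff_pExp, mul_smul_comm, smul_smul,
        smul_mul_assoc, ← zpow_natCast c j, ← zpow_add₀ hc, hn, zpow_natCast]
  · intro n hn
    rw [pshift_scale_coeff, hM n hn, map_zero, smul_zero]

theorem scale_qFun {c : K} (hc : c ≠ 0) (s : K) (L : List ℕ) :
    scale c (qFun s L) = c ^ L.sum • qFun s L := by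
  induction L with
  | nil => simp
  | cons k L ih =>
    rw [qFun_cons, scale_vertex hc, ih, map_smul, smul_smul, List.sum_cons, pow_add, zpow_natCast]

theorem dualFun_scale {c : K} (hc : c ≠ 0) (s : K) (L : List ℕ) (v : Sym K) :
    dualFun s L (scale c v) = c ^ L.sum * dualFun s L v := by
  induction L generalizing v with
  | nil =>
    have : (eps : Sym K →ₐ[K] K).comp (scale c) = eps :=
      MvPolynomial.algHom_ext fun k => by simp [eps, scale]
    simpa using DFunLike.congr_fun this v
  | cons k L ih =>
    have h : vertex s (-1) (-k) (scale c v) = c ^ k • scale c (vertex s (-1) (-k) v) := by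
      rw [scale_vertex hc, smul_smul, ← zpow_natCast, ← zpow_add₀ hc, add_neg_cancel, zpow_zero,
        one_smul]
    rw [dualFun_cons, h, map_smul, ih, dualFun_cons, List.sum_cons, pow_add, smul_eq_mul, mul_assoc]

end Grading

/-! ### Partitions as decreasing lists, with `n(λ)` and `b_λ` computed recursively. -/

section Partitions

theorem partsList_pairwise {n : ℕ} (lam : n.Partition) : (partsList lam).Pairwise (· ≥ ·) :=
  Multiset.pairwise_sort _ _

theorem partsList_pos {n : ℕ} (lam : n.Partition) : ∀ x ∈ partsList lam, 0 < x :=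
  fun _ hx => lam.parts_pos ((Multiset.mem_sort _).1 hx)

theorem coe_partsList {n : ℕ} (lam : n.Partition) : (partsList lam : Multiset ℕ) = lam.parts :=
  Multiset.sort_eq _ _

theorem partsList_sum {n : ℕ} (lam : n.Partition) : (partsList lam).sum = n := by
  rw [← Multiset.sum_coe, coe_partsList, lam.parts_sum]

theorem partsList_injective {n : ℕ} : Function.Injective (partsList (n := n)) := fun lam mu h =>
  Nat.Partition.ext (by rw [← coe_partsList, h, coe_partsList])

theorem length_partsList {n : ℕ} (lam : n.Partition) : (partsList lam).length = len lam := by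
  rw [len, ← coe_partsList, Multiset.coe_card]

theorem partsList_emptyPartition : partsList emptyPartition = [] := by
  rw [partsList, emptyPartition, Multiset.sort_zero]

theorem partsList_onePartition (n : ℕ) : partsList (onePartition n) = List.replicate n 1 := by
  refine List.eq_replicate_iff.2 ⟨?_, fun x hx => ?_⟩
  · rw [length_partsList, len, onePartition, Multiset.card_replicate]
  · exact Multiset.eq_of_mem_replicate ((Multiset.mem_sort _).1 hx)

/-- `n(λ)` for a list. -/
def nList : List ℕ → ℕ
  | [] => 0
  | _ :: L => L.sum + nList L

theorem nStat_eq {n : ℕ} (lam : n.Partition) : nStat lam = nList (partsList lam) := by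
  rw [nStat]
  generalize partsList lam = L
  induction L with
  | nil => simp [nList]
  | cons k L ih =>
    have h : ∑ i ∈ range L.length, L.getD i 0 = L.sum := by
      clear ih
      induction L with
      | nil => simp
      | cons x L ih =>
        rw [List.length_cons, sum_range_succ', List.sum_cons, add_comm, ← ih]
        simp
    rw [List.length_cons, sum_range_succ', nList, ← ih, ← h, ← sum_add_distrib]
    simp only [zero_mul, add_zero, List.getD_cons_succ]
    exact sum_congr rfl fun i _ => by ring

theorem bList_eq_prod {K : Type*} [Field K] (s : K) (L : List ℕ) :
    bList s L = ∏ i ∈ L.toFinset, ∏ k ∈ Icc 1 (L.count i), (1 - s ^ k) := by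
  induction L with
  | nil => simp [bList]
  | cons x L ih =>
    have h : ∀ i, ∏ k ∈ Icc 1 ((x :: L).count i), (1 - s ^ k) =
        (if i = x then 1 - s ^ (L.count x + 1) else 1) * ∏ k ∈ Icc 1 (L.count i), (1 - s ^ k) := by
      intro i
      by_cases hi : i = x
      · rw [if_pos hi, hi, List.count_cons_self, prod_Icc_succ_top (by omega), mul_comm]
      · rw [if_neg hi, one_mul, List.count_cons_of_ne (Ne.symm hi)]
    simp only [h, prod_mul_distrib, prod_ite_eq', bList, List.count_cons_self, ih]
    rw [if_pos (by simp)]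
    congr 1
    refine prod_subset (by intro y; simp; tauto) fun y _ hy => ?_
    rw [List.count_eq_zero.2 (by simpa using hy)]
    simp

theorem bFactor_eq {K : Type*} [Field K] {n : ℕ} (lam : n.Partition) (s : K) :
    bFactor lam s = bList s (partsList lam) := by
  rw [bFactor, bList_eq_prod, ← coe_partsList]
  simp only [Multiset.coe_count]
  exact prod_congr (by ext; simp) fun _ _ => rfl

theorem bList_ne_zero {K : Type*} [Field K] {s : K} (hs : ∀ n : ℕ, 0 < n → s ^ n ≠ 1)
    (L : List ℕ) : bList s L ≠ 0 := by
  rw [bList_eq_prod]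
  refine prod_ne_zero_iff.2 fun i _ => prod_ne_zero_iff.2 fun k hk => ?_
  exact sub_ne_zero.2 (hs k (by have := (mem_Icc.1 hk).1; omega)).symm

end Partitions

/-! ### The `Q_λ` as a basis of each homogeneous component. -/

section Completeness

variable {K : Type*} [Field K]

/-- The homogeneous component of degree `n`. -/
def degreeSpace (K : Type*) [Field K] (n : ℕ) : Submodule K (Sym K) :=
  Module.End.eigenspace (scale (2 : K)).toLinearMap (2 ^ n)

theorem mem_degreeSpace {n : ℕ} {v : Sym K} :
    v ∈ degreeSpace K n ↔ scale 2 v = (2 : K) ^ n • v := Module.End.mem_eigenspace_iff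

variable [CharZero K]

/-- In characteristic zero the powers of `2` are distinct, so the single scaling by `2` separates
all degrees. -/
theorem two_pow_injective {m n : ℕ} (h : (2 : K) ^ m = 2 ^ n) : m = n := by
  have : ((2 ^ m : ℕ) : K) = ((2 ^ n : ℕ) : K) := by exact_mod_cast h
  exact Nat.pow_right_injective le_rfl (Nat.cast_injective this)

theorem qFun_mem_degreeSpace (s : K) (L : List ℕ) : qFun s L ∈ degreeSpace K L.sum :=
  mem_degreeSpace.2 (scale_qFun two_ne_zero s L)

theorem dualFun_eq_zero_of_mem (s : K) {L : List ℕ} {n : ℕ} {v : Sym K}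
    (hv : v ∈ degreeSpace K n) (h : L.sum ≠ n) : dualFun s L v = 0 := by
  have h1 := dualFun_scale two_ne_zero s L v
  rw [mem_degreeSpace.1 hv, map_smul, smul_eq_mul] at h1
  by_contra h2
  exact h (two_pow_injective (mul_right_cancel₀ h2 h1)).symm

/-- The exponent of the monomial `p_λ`. -/
def partExponent {n : ℕ} (lam : n.Partition) : ℕ+ →₀ ℕ :=
  (Multiset.toFinsupp lam.parts).comapDomain PNat.val PNat.coe_injective.injOn

theorem exists_partExponent (m : ℕ+ →₀ ℕ) :
    ∃ lam : (m.sum fun k e => e * (k : ℕ)).Partition, partExponent lam = m := by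
  refine ⟨⟨(Finsupp.toMultiset m).map PNat.val, ?_, ?_⟩, ?_⟩
  · intro i hi
    obtain ⟨k, _, rfl⟩ := Multiset.mem_map.1 hi
    exact k.pos
  · rw [Finsupp.toMultiset_map, Finsupp.sum_toMultiset]
    rw [Finsupp.sum_mapDomain_index (by simp) (by intros; simp [add_mul])]
    simp
  · ext k
    rw [partExponent, Finsupp.comapDomain_apply, Multiset.toFinsupp_apply,
      Multiset.count_map_eq_count' _ _ PNat.coe_injective, Finsupp.count_toMultiset]

theorem degreeSpace_ext {n : ℕ} {v : Sym K} (hv : v ∈ degreeSpace K n)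
    (h : ∀ lam : n.Partition, MvPolynomial.coeff (partExponent lam) v = 0) : v = 0 := by
  ext m
  rw [MvPolynomial.coeff_zero]
  have h1 := congrArg (MvPolynomial.coeff m) (mem_degreeSpace.1 hv)
  rw [coeff_scale, MvPolynomial.coeff_smul, smul_eq_mul] at h1
  by_contra h2
  have h3 := two_pow_injective (mul_right_cancel₀ h2 h1)
  subst h3
  obtain ⟨lam, hlam⟩ := exists_partExponent m
  exact h2 (hlam ▸ h lam)

/-- The coefficients of the monomials `p_λ`. -/
def partCoeff (K : Type*) [Field K] (n : ℕ) : degreeSpace K n →ₗ[K] (n.Partition → K) :=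
  LinearMap.pi fun lam => (MvPolynomial.lcoeff K (partExponent lam)).comp (degreeSpace K n).subtype

theorem partCoeff_injective (n : ℕ) : Function.Injective (partCoeff K n) := by
  rw [← LinearMap.ker_eq_bot, LinearMap.ker_eq_bot']
  intro v hv
  exact Subtype.ext (degreeSpace_ext v.2 fun lam => congrFun hv lam)

theorem dualFun_qFun_partsList (s : K) {m n : ℕ} (lam : m.Partition) (mu : n.Partition) :
    dualFun s (partsList lam) (qFun s (partsList mu)) =
      if partsList lam = partsList mu then bList s (partsList lam) else 0 :=
  dualFun_qFun s _ _ (partsList_pairwise _) (partsList_pairwise _) (partsList_pos _)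
    (partsList_pos _)

/-- The functions `Q_λ` form a basis of the homogeneous component. -/
theorem eq_sum_dualFun_smul_qFun {s : K} (hs : ∀ n : ℕ, 0 < n → s ^ n ≠ 1) {n : ℕ} {v : Sym K}
    (hv : v ∈ degreeSpace K n) :
    v = ∑ lam : n.Partition, (dualFun s (partsList lam) v / bList s (partsList lam)) •
      qFun s (partsList lam) := by
  let q : n.Partition → degreeSpace K n := fun lam => ⟨qFun s (partsList lam), by
    have := qFun_mem_degreeSpace s (partsList lam)
    rwa [partsList_sum] at this⟩
  have hd : ∀ (c : n.Partition → K) (lam : n.Partition),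
      dualFun s (partsList lam) (∑ mu, c mu • qFun s (partsList mu)) =
        c lam * bList s (partsList lam) := by
    intro c lam
    rw [map_sum, sum_eq_single lam]
    · rw [map_smul, dualFun_qFun_partsList, if_pos rfl, smul_eq_mul]
    · intro mu _ hmu
      rw [map_smul, dualFun_qFun_partsList, if_neg fun h => hmu (partsList_injective h).symm,
        smul_zero]
    · simp
  have hli : LinearIndependent K q := by
    rw [Fintype.linearIndependent_iff]
    intro c hc lam
    have h1 := hd c lam
    have h2 := congrArg Subtype.val hc
    simp only [q, AddSubmonoidClass.coe_finsetSum, Submodule.coe_smul, ZeroMemClass.coe_zero] at h2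
    rw [h2, map_zero] at h1
    exact (mul_eq_zero.1 h1.symm).resolve_right (bList_ne_zero hs _)
  -- Monomial coefficients bound the dimension by the number of partitions, so the independent
  -- family `q` of that size must span.
  have hfin : Module.Finite K (degreeSpace K n) := Module.Finite.of_injective _ (partCoeff_injective n)
  have hcard : Fintype.card n.Partition = Module.finrank K (degreeSpace K n) := by
    refine le_antisymm hli.fintype_card_le_finrank ?_
    have := LinearMap.finrank_le_finrank_of_injective (partCoeff_injective (K := K) n)
    rwa [Module.finrank_fintype_fun_eq_card] at this
  have hspan := hli.span_eq_top_of_card_eq_finrank' hcard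
  have hv' : (⟨v, hv⟩ : degreeSpace K n) ∈ Submodule.span K (Set.range q) := by
    rw [hspan]; trivial
  obtain ⟨c, hc⟩ := (Submodule.mem_span_range_iff_exists_fun K).1 hv'
  have hc := congrArg Subtype.val hc
  simp only [q, AddSubmonoidClass.coe_finsetSum, Submodule.coe_smul] at hc
  have hb : ∀ lam : n.Partition,
      dualFun s (partsList lam) v / bList s (partsList lam) = c lam := fun lam => by
    rw [← hc, hd, mul_div_cancel_right₀ _ (bList_ne_zero hs _)]
  simp only [hb, hc]

end Completeness

/-! ### The involution `p_k ↦ -p_k`, its matrix in the `Q_λ`, and the entries at `(1^n)`. -/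

section Entries

variable {K : Type*} [Field K]

/-- The involution `p_k ↦ -p_k`. -/
def iota : Sym K →ₐ[K] Sym K := MvPolynomial.aeval fun k => -MvPolynomial.X k

theorem iota_iota (v : Sym K) : iota (iota v) = v := by
  have : (iota : Sym K →ₐ[K] Sym K).comp iota = AlgHom.id K _ :=
    MvPolynomial.algHom_ext fun k => by simp [iota]
  exact DFunLike.congr_fun this v

theorem iota_scale (c : K) (v : Sym K) : iota (scale c v) = scale c (iota v) := by
  have : (iota : Sym K →ₐ[K] Sym K).comp (scale c) = (scale c).comp iota :=
    MvPolynomial.algHom_ext fun k => by simp [iota, scale]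
  exact DFunLike.congr_fun this v

theorem iota_mem_degreeSpace {n : ℕ} {v : Sym K} (hv : v ∈ degreeSpace K n) :
    iota v ∈ degreeSpace K n := by
  rw [mem_degreeSpace] at hv ⊢
  rw [← iota_scale, hv, map_smul]

theorem iota_coeff_pExp (a : ℕ+ → K) (n : ℕ) :
    iota (PowerSeries.coeff n (pExp a)) = PowerSeries.coeff n (pExp fun k => -a k) := by
  rw [map_coeff_pExp, pExp]
  simp [iota]

theorem iota_vertex (s c : K) (l : ℤ) (v : Sym K) :
    iota (vertex s c l v) = vertex s (-c) l (iota v) := by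
  have hq : PowerSeries.map (iota (K := K) : Sym K →+* Sym K) (qSeries s c) = qSeries s (-c) := by
    ext1 n
    rw [PowerSeries.coeff_map, RingHom.coe_coe, qSeries, iota_coeff_pExp, qSeries]
    simp only [neg_mul]
  have h2 : (Polynomial.mapAlgHom iota).comp (pshift (-c)) =
      (pshift (- -c) : Sym K →ₐ[K] _).comp iota := by
    refine MvPolynomial.algHom_ext fun k => ?_
    simp [pshift, iota]
    ring
  have h3 := DFunLike.congr_fun h2 v
  simp only [AlgHom.comp_apply, Polynomial.coe_mapAlgHom] at h3
  have h1 := contract_map (iota (K := K) : Sym K →+* Sym K) (qSeries s c) l (pshift (-c) v)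
  rw [h3, hq] at h1
  exact h1

/-- The complete homogeneous symmetric functions. -/
def hFun (n : ℕ) : Sym K := PowerSeries.coeff n (pExp fun k => ((k : ℕ) : K)⁻¹)

theorem hFun_zero : (hFun 0 : Sym K) = 1 := coeff_zero_expSeries _

theorem pshift_coeff_zero (c : K) (v : Sym K) : (pshift c v).coeff 0 = v := by
  have h : (Polynomial.constantCoeff (R := Sym K)).comp (pshift c : Sym K →+* _) =
      RingHom.id _ := by
    refine MvPolynomial.ringHom_ext (fun r => ?_) fun k => ?_
    · simp [pshift]
    · simp [pshift, k.ne_zero.symm]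
  exact DFunLike.congr_fun h v

/-- The specialization `p_k ↦ 1 / (1 - s^k)`. -/
def spec (s : K) : Sym K →ₐ[K] K := MvPolynomial.aeval fun k => (1 - s ^ (k : ℕ))⁻¹

variable [CharZero K]

theorem hFun_mem_degreeSpace (n : ℕ) : (hFun n : Sym K) ∈ degreeSpace K n :=
  mem_degreeSpace.2 (scale_coeff_pExp _ _ _)

theorem vertex_coeff_pExp (s : K) (l : ℤ) (a : ℕ+ → K) (n : ℕ) (γ : ℕ → K)
    (hγ : ∀ j, PowerSeries.coeff j (expSeries K fun k => (a k * 1) •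
      (Polynomial.X : Polynomial (Sym K)) ^ (k : ℕ)) = γ j • Polynomial.X ^ j) :
    vertex s (-1) l (PowerSeries.coeff n (pExp a)) = ∑ p ∈ antidiagonal n,
      γ p.2 • (intCoeff (qSeries s (-1)) (l + p.2) * PowerSeries.coeff p.1 (pExp a)) := by
  rw [vertex_apply, neg_neg, pshift_coeff_pExp, map_sum]
  refine sum_congr rfl fun p _ => ?_
  rw [hγ, mul_smul_comm, Polynomial.C_mul_X_pow_eq_monomial, Polynomial.smul_monomial,
    contract_monomial, mul_smul_comm]

/-- Translation multiplies the generating series `H(z)` of the `h_n` by a geometric series, all of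
whose coefficients are `1`. The remaining convolution is a coefficient of `H(z) exp(-∑ (1 - s^k)/k
p_k z^k) = H(s z)`. -/
theorem vertex_hFun (s : K) (k n : ℕ) :
    vertex s (-1) (-k) (hFun (k + n)) = s ^ n • hFun n := by
  rw [hFun, vertex_coeff_pExp s _ _ _ (fun _ => 1) fun j => by
    simp only [mul_one]
    rw [expSeries_pow_div, PowerSeries.coeff_mk, one_smul]]
  have h : pExp (fun k : ℕ+ => ((k : ℕ) : K)⁻¹) * qSeries s (-1) =
      expSeries K fun k => s ^ (k : ℕ) • (((k : ℕ) : K)⁻¹ • (MvPolynomial.X k : Sym K)) := by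
    rw [qSeries, pExp_mul, pExp]
    congr 1
    funext k
    rw [smul_smul]
    congr 1
    ring
  have h1 := congrArg (PowerSeries.coeff n) h
  rw [expSeries_smul_pow] at h1
  change _ = s ^ n • hFun n at h1
  rw [← h1, PowerSeries.coeff_mul]
  symm
  refine sum_of_injOn (fun p => (p.1, p.2 + k)) ?_ ?_ ?_ ?_
  · rintro ⟨a, b⟩ _ ⟨c, d⟩ _ h
    simpa using h
  · intro p hp
    have hp := HasAntidiagonal.mem_antidiagonal.1 (mem_coe.1 hp)
    rw [mem_coe, HasAntidiagonal.mem_antidiagonal]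
    simp only
    omega
  · rintro ⟨a, b⟩ hp hp'
    have hp := HasAntidiagonal.mem_antidiagonal.1 hp
    simp only at hp ⊢
    rw [intCoeff_of_neg, zero_mul, smul_zero]
    by_contra hb
    refine hp' ⟨(a, b - k), ?_, ?_⟩
    · rw [mem_coe, HasAntidiagonal.mem_antidiagonal]
      simp only
      omega
    · simp only [Prod.mk.injEq, true_and]
      omega
  · intro p _
    rw [one_smul, show (-(k : ℤ) + (p.2 + k : ℕ)) = (p.2 : ℤ) by push_cast; ring,
      intCoeff_natCast, mul_comm]

theorem dualFun_hFun (s : K) (L : List ℕ) : dualFun s L (hFun L.sum) = s ^ nList L := by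
  induction L with
  | nil => simp [hFun_zero, nList]
  | cons k L ih =>
    rw [dualFun_cons, List.sum_cons, vertex_hFun, map_smul, ih, nList, pow_add, smul_eq_mul]

/-- For `1 / H` the translation factor is `1 - y z`, so the degree in `y` is at most one and a
lowering mode below `-1` finds nothing to contract. -/
theorem vertex_iota_hFun (s : K) {k : ℕ} (hk : 0 < k) (n : ℕ) :
    vertex s (-1) (-k) (iota (hFun (k + n))) = if k = 1 then -iota (hFun n) else 0 := by
  rw [hFun, iota_coeff_pExp, vertex_coeff_pExp s _ _ _
    (fun j => if j = 0 then 1 else if j = 1 then -1 else 0) fun j => by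
      have := expSeries_neg_pow_div (K := K) (Polynomial.X : Polynomial (Sym K))
      simp only [mul_one, neg_smul]
      rw [this, map_sub, PowerSeries.coeff_C_mul, PowerSeries.coeff_X, PowerSeries.coeff_one]
      split_ifs <;> simp_all]
  rw [sum_eq_single (k + n - 1, 1)]
  · by_cases h : k = 1
    · subst h
      rw [hFun, iota_coeff_pExp]
      simp [intCoeff, qSeries, pExp]
    · rw [intCoeff_of_neg _ (by simp only; omega), if_neg h, zero_mul, smul_zero]
  · rintro ⟨a, b⟩ hp hne
    have hp := HasAntidiagonal.mem_antidiagonal.1 hp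
    simp only at hp ⊢
    split_ifs with h1 h2
    · rw [intCoeff_of_neg _ (by omega), zero_mul, smul_zero]
    · exact absurd (by ext <;> simp <;> omega) hne
    · rw [zero_smul]
  · intro h
    rw [HasAntidiagonal.mem_antidiagonal] at h
    simp only at h
    omega

theorem dualFun_iota_hFun (s : K) (L : List ℕ) (hL : ∀ x ∈ L, 0 < x) :
    dualFun s L (iota (hFun L.sum)) = if ∀ x ∈ L, x = 1 then (-1) ^ L.sum else 0 := by
  induction L with
  | nil => simp [hFun_zero]
  | cons k L ih =>
    rw [dualFun_cons, List.sum_cons, vertex_iota_hFun s (hL k (by simp))]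
    simp only [List.forall_mem_cons] at hL ⊢
    by_cases hk : k = 1
    · rw [if_pos hk, map_neg, ih hL.2, hk]
      by_cases h : ∀ x ∈ L, x = 1
      · rw [if_pos h, if_pos ⟨rfl, h⟩]; ring
      · rw [if_neg h, if_neg fun h' => h h'.2, neg_zero]
    · rw [if_neg hk, if_neg fun h' => hk h'.1, map_zero]

/-- Under `spec` the creation half becomes `1 / (1 - z)`, so for `k ≥ 0` the contraction is
evaluation at `y = 1`. There the translation gives `1/(1 - s^k) - 1 = s^k/(1 - s^k)`, which is the
scaling by `s`. -/
theorem spec_vertex {s : K} (hs : ∀ n : ℕ, 0 < n → s ^ n ≠ 1) (k : ℕ) (v : Sym K) : spec s (vertex s 1 k v) = spec s (scale s v) := by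
  have hq : ∀ n, spec s (PowerSeries.coeff n (qSeries s 1)) = 1 := by
    intro n
    have h := expSeries_pow_div (K := K) (1 : K)
    rw [qSeries, map_coeff_pExp]
    have h' : (fun k : ℕ+ => (1 * ((1 - s ^ (k : ℕ)) / ((k : ℕ) : K))) •
        spec s (MvPolynomial.X k)) = fun k : ℕ+ => ((k : ℕ) : K)⁻¹ • (1 : K) ^ (k : ℕ) := by
      funext k
      have := sub_ne_zero.2 (hs k k.pos).symm
      have hk : ((k : ℕ) : K) ≠ 0 := by exact_mod_cast k.ne_zero
      simp only [spec, MvPolynomial.aeval_X, smul_eq_mul, one_pow]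
      field_simp
    rw [h', h, PowerSeries.coeff_mk, one_pow]
  have h1 : ∀ p : Polynomial (Sym K), spec s (contract (qSeries s 1) k p) =
      Polynomial.eval₂RingHom (spec s : Sym K →+* K) 1 p := by
    intro p
    induction p using Polynomial.induction_on' with
    | add p q hp hq => simp only [map_add, hp, hq]
    | monomial n u =>
      rw [contract_monomial, ← Nat.cast_add, intCoeff_natCast, map_mul, hq]
      simp
  have h2 : (Polynomial.eval₂RingHom (spec s : Sym K →+* K) 1).comp
      (pshift (-1 : K) : Sym K →+* Polynomial (Sym K)) = (spec s : Sym K →+* K).comp (scale s : Sym K →+* Sym K) := by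
    refine MvPolynomial.ringHom_ext (fun r => ?_) fun k => ?_
    · simp [pshift, spec, scale]
    · have := sub_ne_zero.2 (hs k k.pos).symm
      simp [pshift, spec, scale]
      field_simp
      ring
  have h3 := DFunLike.congr_fun h2 v
  simp only [RingHom.comp_apply, RingHom.coe_coe] at h3
  rw [vertex_apply, h1, h3]

theorem spec_qFun {s : K} (hs : ∀ n : ℕ, 0 < n → s ^ n ≠ 1) (hs0 : s ≠ 0) (L : List ℕ) : spec s (qFun s L) = s ^ nList L := by
  induction L with
  | nil => simp [nList]
  | cons k L ih =>
    rw [qFun_cons, spec_vertex hs, scale_qFun hs0, map_smul, ih, nList, pow_add, smul_eq_mul]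

/-- Composed with `ι`, the creation half becomes `1 - z`; a mode `k ≥ 1` then sees only its linear
term. -/
theorem spec_iota_vertex {s : K} (hs : ∀ n : ℕ, 0 < n → s ^ n ≠ 1) {k : ℕ} (hk : 0 < k) (v : Sym K) :
    spec s (iota (vertex s 1 k v)) = if k = 1 then -spec s (iota v) else 0 := by
  have hq : ∀ n, spec s (iota (PowerSeries.coeff n (qSeries s 1))) =
      PowerSeries.coeff n (1 - PowerSeries.C (1 : K) * PowerSeries.X) := by
    intro n
    rw [← expSeries_neg_pow_div (K := K), qSeries, iota_coeff_pExp, map_coeff_pExp]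
    congr 2
    funext k
    have := sub_ne_zero.2 (hs k k.pos).symm
    have hk : ((k : ℕ) : K) ≠ 0 := by exact_mod_cast k.ne_zero
    simp only [spec, MvPolynomial.aeval_X, smul_eq_mul, one_pow]
    field_simp
  have h1 : ∀ p : Polynomial (Sym K), spec s (iota (contract (qSeries s 1) k p)) =
      if k = 1 then -spec s (iota (p.coeff 0)) else 0 := by
    intro p
    induction p using Polynomial.induction_on' with
    | add p q hp hq =>
      simp only [map_add, hp, hq, Polynomial.coeff_add]
      split_ifs <;> ring
    | monomial n u =>
      rw [contract_monomial, ← Nat.cast_add, intCoeff_natCast, map_mul, map_mul, hq, map_sub,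
        PowerSeries.coeff_C_mul, PowerSeries.coeff_X, PowerSeries.coeff_one, if_neg (by omega),
        Polynomial.coeff_monomial]
      have : k + n = 1 ↔ k = 1 ∧ n = 0 := by omega
      simp only [this]
      split_ifs <;> simp_all
  rw [vertex_apply, h1, pshift_coeff_zero]

theorem spec_iota_qFun {s : K} (hs : ∀ n : ℕ, 0 < n → s ^ n ≠ 1) (L : List ℕ) (hL : ∀ x ∈ L, 0 < x) :
    spec s (iota (qFun s L)) = if ∀ x ∈ L, x = 1 then (-1) ^ L.sum else 0 := by
  induction L with
  | nil => simp
  | cons k L ih =>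
    rw [qFun_cons, List.sum_cons, spec_iota_vertex hs (hL k (by simp))]
    simp only [List.forall_mem_cons] at hL ⊢
    by_cases hk : k = 1
    · rw [if_pos hk, ih hL.2, hk]
      by_cases h : ∀ x ∈ L, x = 1
      · rw [if_pos h, if_pos ⟨rfl, h⟩]; ring
      · rw [if_neg h, if_neg fun h' => h h'.2, neg_zero]
    · rw [if_neg hk, if_neg fun h' => hk h'.1]

theorem forall_mem_partsList_eq_one {n : ℕ} (lam : n.Partition) :
    (∀ x ∈ partsList lam, x = 1) ↔ lam = onePartition n := by
  constructor
  · intro h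
    refine partsList_injective ?_
    rw [partsList_onePartition]
    have h1 := List.eq_replicate_iff.2 ⟨rfl, h⟩
    have h2 := partsList_sum lam
    rw [h1, List.sum_replicate, smul_eq_mul, mul_one] at h2
    rw [h1, h2]
  · rintro rfl x hx
    rw [partsList_onePartition] at hx
    exact List.eq_of_mem_replicate hx

/-- The pairing of `Q_λ` and `ι Q_μ`. -/
def pairing (s : K) (n : ℕ) : Matrix n.Partition n.Partition K :=
  Matrix.of fun lam mu => dualFun s (partsList lam) (iota (qFun s (partsList mu)))

/-- The inverse of `pairing`. -/
def pairingInv (s : K) (n : ℕ) : Matrix n.Partition n.Partition K :=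
  Matrix.of fun lam mu => pairing s n lam mu /
    (bList s (partsList lam) * bList s (partsList mu))

/-- The coefficients of `h_n` with respect to the `Q_λ`, up to sign. -/
def hCoeff (s : K) {n : ℕ} (lam : n.Partition) : K :=
  (-1) ^ n * s ^ nList (partsList lam) / bList s (partsList lam)

theorem qFun_partsList_mem (s : K) {n : ℕ} (mu : n.Partition) :
    qFun s (partsList mu) ∈ degreeSpace K n := by
  have := qFun_mem_degreeSpace s (partsList mu)
  rwa [partsList_sum] at this

/-- Expand `ι Q_ν` in the basis, apply `ι` once more and pair with `Q_λ`: the relation `ι² = 1`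
becomes the matrix identity. -/
theorem pairing_mul_pairingInv {s : K} (hs : ∀ n : ℕ, 0 < n → s ^ n ≠ 1) (n : ℕ) : pairing s n * pairingInv s n = 1 := by
  ext lam nu
  have h := eq_sum_dualFun_smul_qFun hs (iota_mem_degreeSpace (qFun_partsList_mem s nu))
  have h1 := congrArg (fun v => dualFun s (partsList lam) (iota v)) h
  simp only [iota_iota, map_sum, map_smul, dualFun_qFun_partsList] at h1
  have hb := bList_ne_zero hs (partsList nu)
  rw [Matrix.mul_apply, Matrix.one_apply]
  have h2 : ∑ mu, pairing s n lam mu * pairingInv s n mu nu = (∑ mu : n.Partition,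
      (dualFun s (partsList mu) (iota (qFun s (partsList nu))) / bList s (partsList mu)) •
        dualFun s (partsList lam) (iota (qFun s (partsList mu)))) / bList s (partsList nu) := by
    rw [sum_div]
    refine sum_congr rfl fun mu _ => ?_
    simp only [pairing, pairingInv, Matrix.of_apply, smul_eq_mul]
    have hb' := bList_ne_zero hs (partsList mu)
    field_simp
  rw [h2, ← h1]
  by_cases h3 : lam = nu
  · rw [h3, if_pos rfl, if_pos rfl, div_self hb]
  · rw [if_neg h3, if_neg fun h4 => h3 (partsList_injective h4), zero_div]

/-- Expand `h_n` in the basis, then pair `ι h_n` with `Q_λ`. -/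
theorem pairing_mulVec_hCoeff {s : K} (hs : ∀ n : ℕ, 0 < n → s ^ n ≠ 1) (n : ℕ) :
    (pairing s n).mulVec (hCoeff s) = Pi.single (onePartition n) 1 := by
  funext lam
  have h := eq_sum_dualFun_smul_qFun hs (hFun_mem_degreeSpace (K := K) n)
  have h1 := congrArg (fun v => dualFun s (partsList lam) (iota v)) h
  have h2 : ∀ mu : n.Partition, dualFun s (partsList mu) (hFun n) = s ^ nList (partsList mu) :=
    fun mu => by
      have := dualFun_hFun s (partsList mu)
      rwa [partsList_sum] at this
  have h3 := dualFun_iota_hFun s (partsList lam) (partsList_pos lam)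
  rw [partsList_sum] at h3
  simp only [h2, h3, forall_mem_partsList_eq_one, map_sum, map_smul] at h1
  have h4 : (pairing s n).mulVec (hCoeff s) lam = (-1) ^ n * ∑ mu : n.Partition,
      (s ^ nList (partsList mu) / bList s (partsList mu)) •
        dualFun s (partsList lam) (iota (qFun s (partsList mu))) := by
    rw [Matrix.mulVec, dotProduct, mul_sum]
    refine sum_congr rfl fun mu _ => ?_
    simp only [pairing, hCoeff, Matrix.of_apply, smul_eq_mul]
    ring
  rw [h4, ← h1, Pi.single_apply]
  split_ifs
  · rw [← mul_pow]; simp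
  · simp

/-- Expand `ι Q_μ` in the basis and apply `spec`. -/
theorem hCoeff_vecMul_pairing {s : K} (hs : ∀ n : ℕ, 0 < n → s ^ n ≠ 1) (hs0 : s ≠ 0) (n : ℕ) :
    Matrix.vecMul (hCoeff s) (pairing s n) = Pi.single (onePartition n) 1 := by
  funext mu
  have h := eq_sum_dualFun_smul_qFun hs (iota_mem_degreeSpace (qFun_partsList_mem s mu))
  have h1 := congrArg (spec s) h
  rw [spec_iota_qFun hs _ (partsList_pos mu), partsList_sum] at h1
  simp only [forall_mem_partsList_eq_one, map_sum, map_smul, spec_qFun hs hs0] at h1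
  have h4 : Matrix.vecMul (hCoeff s) (pairing s n) mu = (-1) ^ n * ∑ lam : n.Partition,
      (dualFun s (partsList lam) (iota (qFun s (partsList mu))) / bList s (partsList lam)) •
        s ^ nList (partsList lam) := by
    rw [Matrix.vecMul, dotProduct, mul_sum]
    refine sum_congr rfl fun lam _ => ?_
    simp only [pairing, hCoeff, Matrix.of_apply, smul_eq_mul]
    ring
  rw [h4, ← h1, Pi.single_apply]
  split_ifs
  · rw [← mul_pow]; simp
  · simp

theorem pairingInv_apply_onePartition {s : K} (hs : ∀ n : ℕ, 0 < n → s ^ n ≠ 1) {n : ℕ} (lam : n.Partition) :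
    pairingInv s n lam (onePartition n) = hCoeff s lam := by
  have h := congrArg (pairingInv s n).mulVec (pairing_mulVec_hCoeff hs n)
  rw [Matrix.mulVec_mulVec, mul_eq_one_comm.1 (pairing_mul_pairingInv hs n), Matrix.one_mulVec,
    Matrix.mulVec_single_one] at h
  exact (congrFun h lam).symm

theorem pairingInv_onePartition_apply {s : K} (hs : ∀ n : ℕ, 0 < n → s ^ n ≠ 1) (hs0 : s ≠ 0) {n : ℕ} (lam : n.Partition) :
    pairingInv s n (onePartition n) lam = hCoeff s lam := by
  have h := congrArg (fun v => Matrix.vecMul v (pairingInv s n)) (hCoeff_vecMul_pairing hs hs0 n)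
  simp only [Matrix.vecMul_vecMul, pairing_mul_pairingInv hs n, Matrix.vecMul_one,
    Matrix.single_one_vecMul] at h
  exact (congrFun h lam).symm

end Entries

/-! ### From the bosonic Fock space to symmetric functions. -/

section Bridge

variable {K : Type*} [Field K]

theorem finsum_modes {R : Type*} [CommRing R] (F : PowerSeries R) (p : Polynomial R) (n : ℤ) :
    ∑ᶠ (r : ℕ) (s : ℕ) (_ : (s : ℤ) - (r : ℤ) = n), PowerSeries.coeff r F * p.coeff s =
      contract F (-n) p := by
  classical
  obtain ⟨N, hN⟩ : ∃ N, ∀ m, N ≤ m → p.coeff m = 0 :=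
    ⟨p.natDegree + 1, fun _ hn => Polynomial.coeff_eq_zero_of_natDegree_lt hn⟩
  have h1 : ∀ r : ℕ, ∑ᶠ (s : ℕ) (_ : (s : ℤ) - (r : ℤ) = n), PowerSeries.coeff r F * p.coeff s =
      ∑ s ∈ range N, if (s : ℤ) - (r : ℤ) = n then PowerSeries.coeff r F * p.coeff s else 0 := by
    intro r
    simp only [finsum_eq_if]
    refine finsum_eq_sum_of_support_subset _ fun s hs => ?_
    rw [Function.mem_support] at hs
    rw [coe_range, Set.mem_Iio]
    by_contra h
    rw [hN s (by omega), mul_zero, ite_self] at hs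
    exact hs rfl
  simp only [h1]
  rw [finsum_eq_sum_of_support_subset (s := range (N + n.natAbs)), sum_comm, contract_eq_sum _ _ hN]
  · refine sum_congr rfl fun s hs => ?_
    have hs := mem_range.1 hs
    rcases lt_or_ge (-n + s) 0 with h | h
    · rw [intCoeff_of_neg _ h, zero_mul]
      exact sum_eq_zero fun r _ => if_neg (by omega)
    · obtain ⟨m, hm⟩ := Int.eq_ofNat_of_zero_le h
      rw [hm, intCoeff_natCast, sum_eq_single m]
      · rw [if_pos (by omega)]
      · intro r _ hr
        rw [if_neg (by omega)]
      · intro h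
        rw [mem_range] at h
        omega
  · intro r hr
    rw [Function.mem_support] at hr
    rw [coe_range, Set.mem_Iio]
    by_contra h
    refine hr (sum_eq_zero fun s hs => if_neg ?_)
    have hs := mem_range.1 hs
    omega

/-- In `ket` and `bra` the integer mode index makes the whole list of parts be coerced to integers
monadically; this and the next lemma undo that. -/
theorem foldr_natCast {M : Type*} (f : ℤ → M → M) (b : M) (L : List ℕ) :
    List.foldr f b (L >>= fun a => pure (a : ℤ)) = L.foldr (fun (k : ℕ) w => f k w) b := by
  induction L with
  | nil => rfl
  | cons k L ih => exact congrArg (f k) ih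

theorem foldl_natCast {M : Type*} (f : M → ℤ → M) (b : M) (L : List ℕ) :
    List.foldl f b (L >>= fun a => pure (a : ℤ)) = L.foldl (fun w (k : ℕ) => f w k) b := by
  induction L generalizing b with
  | nil => rfl
  | cons k L ih => exact ih (f b k)

theorem expCoeff_bMinus (α : Fin 2 → ℕ+ → K) (r : ℕ) (w : Fock K) :
    expCoeff (fun k => ∑ i, α i k • bMinus i k) r w =
      PowerSeries.coeff r (expSeries K fun k => ∑ i, α i k • (MvPolynomial.X (i, k) : Fock K)) *
        w := by
  have h := congrArg (fun F : PowerSeries (Module.End K (Fock K)) => PowerSeries.coeff r F w)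
    (map_expSeries (Algebra.lmul K (Fock K))
      fun k => ∑ i, α i k • (MvPolynomial.X (i, k) : Fock K))
  simp only [PowerSeries.coeff_map, RingHom.coe_coe, map_sum, map_smul] at h
  refine Eq.trans ?_ h.symm
  rw [expSeries, PowerSeries.coeff_mk]
  rfl

/-- The embedding `p_k ↦ b²_{-k}`. -/
def embTwo : Sym K →ₐ[K] Fock K := MvPolynomial.aeval fun k => MvPolynomial.X (1, k)

/-- The embedding `p_k ↦ b²_{-k} - b¹_{-k}`. -/
def embDiff : Sym K →ₐ[K] Fock K :=
  MvPolynomial.aeval fun k => MvPolynomial.X (1, k) - MvPolynomial.X (0, k)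

/-- The projection `b¹_{-k} ↦ p_k`, `b²_{-k} ↦ 0`. -/
def projOne : Fock K →ₐ[K] Sym K :=
  MvPolynomial.aeval fun p => if p.1 = 0 then MvPolynomial.X p.2 else 0

theorem map_qSeries {R : Type*} [CommRing R] [Algebra K R] (f : Sym K →ₐ[K] R) (t : K) :
    PowerSeries.map (f : Sym K →+* R) (qSeries t⁻¹ 1) =
      expSeries K fun k => cMinus t k • f (MvPolynomial.X k) := by
  rw [qSeries, pExp, map_expSeries]
  simp only [map_smul, one_mul, cMinus]

theorem eps_foldl_vertex (s c : K) (L : List ℕ) (f : Sym K) :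
    eps (L.foldl (fun w (k : ℕ) => c • vertex s 1 (-k) w) f) =
      c ^ L.length * dualFun s L (iota f) := by
  induction L generalizing f with
  | nil =>
    have h : (eps : Sym K →ₐ[K] K).comp iota = eps :=
      MvPolynomial.algHom_ext fun k => by simp [eps, iota]
    simpa using (DFunLike.congr_fun h f).symm
  | cons k L ih =>
    rw [List.foldl_cons, ih, map_smul, map_smul, iota_vertex, dualFun_cons, List.length_cons,
      pow_succ, smul_eq_mul, mul_assoc]

variable [CharZero K]

theorem expCoeff_bPlus (t : K) (β : Fin 2 → ℕ+ → K) (r : ℕ) (w : Fock K) :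
    expCoeff (fun k => ∑ i, β i k • bPlus t i k) r w =
      (shift Prod.snd (fun p => β p.1 p.2 * (((p.2 : ℕ) : K) / (1 - t ^ (p.2 : ℕ)))) w).coeff r := by
  rw [← coeff_expSeries_derivation Prod.snd _ (fun k => ∑ i : Fin 2,
    (β i k * (((k : ℕ) : K) / (1 - t ^ (k : ℕ)))) • MvPolynomial.pderiv (i, k))]
  · have : (fun k => ∑ i, β i k • bPlus t i k) = fun k => ((∑ i : Fin 2,
        (β i k * (((k : ℕ) : K) / (1 - t ^ (k : ℕ)))) • MvPolynomial.pderiv (i, k) :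
          Derivation K (Fock K) (Fock K)) : Module.End K (Fock K)) := by
      funext k
      ext1 v
      simp [bPlus, mul_smul]
    rw [this, expSeries, PowerSeries.coeff_mk]
    rfl
  · rintro k ⟨i, l⟩
    by_cases hkl : l = k
    · subst hkl
      fin_cases i <;>
        simp [MvPolynomial.pderiv_X, MvPolynomial.smul_eq_C_mul]
    · simp [MvPolynomial.pderiv_X, hkl]

theorem vertexMode_eq (t : K) (α β : Fin 2 → ℕ+ → K) (n : ℤ) (v : Fock K) :
    vertexMode t α β n v =
      contract (expSeries K fun k => ∑ i, α i k • (MvPolynomial.X (i, k) : Fock K)) (-n)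
        (shift Prod.snd (fun p => β p.1 p.2 * (((p.2 : ℕ) : K) / (1 - t ^ (p.2 : ℕ)))) v) := by
  rw [vertexMode, ← finsum_modes]
  simp only [expCoeff_bMinus, expCoeff_bPlus]

theorem cPlus_mul {t : K} (ht : ∀ n : ℕ, 0 < n → t ^ n ≠ 1) (k : ℕ+) :
    cPlus t k * (((k : ℕ) : K) / (1 - t ^ (k : ℕ))) = -1 := by
  have := sub_ne_zero.2 (ht k k.pos).symm
  have hk : ((k : ℕ) : K) ≠ 0 := by exact_mod_cast k.ne_zero
  rw [cPlus]
  field_simp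

/-- The annihilation half translates `b¹` and `b²` by the same amount, so it fixes the differences
`b² - b¹`. The mode `n` is the coefficient of `z^{-n}`, hence the sign of the index. -/
theorem vertexMode_X2 {t : K} (ht : ∀ n : ℕ, 0 < n → t ^ n ≠ 1)
    (n : ℤ) (f g : Sym K) :
    vertexMode t ![0, cMinus t] ![cPlus t, cPlus t] n (embTwo f * embDiff g) =
      embTwo (vertex t⁻¹ 1 (-n) f) * embDiff g := by
  have h1 : (shift Prod.snd (fun p : Fin 2 × ℕ+ => (![cPlus t, cPlus t] : Fin 2 → ℕ+ → K) p.1 p.2 *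
      (((p.2 : ℕ) : K) / (1 - t ^ (p.2 : ℕ))))).comp embTwo =
      (Polynomial.mapAlgHom embTwo).comp (pshift (-1)) := by
    refine MvPolynomial.algHom_ext fun k => ?_
    simp [embTwo, pshift, cPlus_mul ht]
  have h2 : (shift Prod.snd (fun p : Fin 2 × ℕ+ => (![cPlus t, cPlus t] : Fin 2 → ℕ+ → K) p.1 p.2 *
      (((p.2 : ℕ) : K) / (1 - t ^ (p.2 : ℕ))))).comp embDiff =
      Polynomial.CAlgHom.comp embDiff := by
    refine MvPolynomial.algHom_ext fun k => ?_
    simp [embDiff, cPlus_mul ht]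
  have h1 := DFunLike.congr_fun h1 f
  have h2 := DFunLike.congr_fun h2 g
  simp only [AlgHom.comp_apply, Polynomial.CAlgHom_apply, Polynomial.coe_mapAlgHom] at h1 h2
  rw [vertexMode_eq, map_mul, h1, h2, contract_mul_C, vertex_apply]
  congr 1
  have h3 := contract_map (embTwo (K := K) : Sym K →+* Fock K) (qSeries t⁻¹ 1) (-n) (pshift (-1) f)
  rw [map_qSeries] at h3
  simp only [RingHom.coe_coe] at h3
  rw [h3]
  simp [embTwo]

theorem vertexMode_Lambda2 {t : K} (ht : ∀ n : ℕ, 0 < n → t ^ n ≠ 1)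
    (n : ℤ) (g : Sym K) :
    vertexMode t ![-cMinus t, cMinus t] ![0, cPlus t] n (embDiff g) =
      embDiff (vertex t⁻¹ 1 (-n) g) := by
  have h1 : (shift Prod.snd (fun p : Fin 2 × ℕ+ => (![0, cPlus t] : Fin 2 → ℕ+ → K) p.1 p.2 *
      (((p.2 : ℕ) : K) / (1 - t ^ (p.2 : ℕ))))).comp embDiff =
      (Polynomial.mapAlgHom embDiff).comp (pshift (-1)) := by
    refine MvPolynomial.algHom_ext fun k => ?_
    simp [embDiff, pshift, cPlus_mul ht]
    ring
  have h1 := DFunLike.congr_fun h1 g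
  simp only [AlgHom.comp_apply, Polynomial.coe_mapAlgHom] at h1
  rw [vertexMode_eq, h1, vertex_apply]
  have h3 := contract_map (embDiff (K := K) : Sym K →+* Fock K) (qSeries t⁻¹ 1) (-n) (pshift (-1) g)
  rw [map_qSeries] at h3
  simp only [RingHom.coe_coe] at h3
  rw [h3]
  congr 2
  refine congrArg (expSeries K) (funext fun k => ?_)
  simp [embDiff, smul_sub]
  ring

/-- `Λ¹` involves the first boson only, so setting `b² = 0` commutes with it. -/
theorem projOne_vertexMode_Lambda1 {t : K} (ht : ∀ n : ℕ, 0 < n → t ^ n ≠ 1)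
    (n : ℤ) (w : Fock K) :
    projOne (vertexMode t ![cMinus t, 0] ![cPlus t, 0] n w) =
      vertex t⁻¹ 1 (-n) (projOne w) := by
  have h1 : (Polynomial.mapAlgHom projOne).comp (shift Prod.snd (fun p : Fin 2 × ℕ+ =>
      (![cPlus t, 0] : Fin 2 → ℕ+ → K) p.1 p.2 *
      (((p.2 : ℕ) : K) / (1 - t ^ (p.2 : ℕ))))) = (pshift (-1)).comp projOne := by
    refine MvPolynomial.algHom_ext fun p => ?_
    obtain ⟨i, k⟩ := p
    fin_cases i <;> simp [projOne, pshift, cPlus_mul ht]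
  have h1 := DFunLike.congr_fun h1 w
  simp only [AlgHom.comp_apply, Polynomial.coe_mapAlgHom] at h1
  have h3 := contract_map (projOne (K := K) : Fock K →+* Sym K) (expSeries K fun k =>
    ∑ i, (![cMinus t, 0] : Fin 2 → ℕ+ → K) i k • (MvPolynomial.X (i, k) : Fock K)) (-n)
    (shift Prod.snd (fun p : Fin 2 × ℕ+ => (![cPlus t, 0] : Fin 2 → ℕ+ → K) p.1 p.2 *
      (((p.2 : ℕ) : K) / (1 - t ^ (p.2 : ℕ)))) w)
  rw [h1, map_expSeries] at h3
  simp only [RingHom.coe_coe] at h3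
  rw [vertexMode_eq, h3, vertex_apply]
  congr 2
  rw [qSeries, pExp]
  congr 1
  funext k
  simp [projOne, cMinus]

theorem foldr_X1 {t : K} (ht : ∀ n : ℕ, 0 < n → t ^ n ≠ 1)
    (u₁ u₂ : K) (L : List ℕ) (hL : ∀ x ∈ L, 0 < x) :
    L.foldr (fun (k : ℕ) w => X1 t u₁ u₂ (-(k : ℤ)) w) 1 =
      embDiff (u₂ ^ L.length • qFun t⁻¹ L) := by
  induction L with
  | nil => simp
  | cons k L ih =>
    have hk := hL k (by simp)
    rw [List.foldr_cons, ih fun x hx => hL x (by simp [hx]), X1, if_neg (by omega),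
      if_pos (by omega), zero_add, Lambda2, vertexMode_Lambda2 ht, neg_neg, map_smul, qFun_cons,
      ← map_smul, smul_smul, List.length_cons, pow_succ']

theorem foldr_X2 {t : K} (ht : ∀ n : ℕ, 0 < n → t ^ n ≠ 1)
    (u₁ u₂ : K) (L : List ℕ) (g : Sym K) :
    L.foldr (fun (k : ℕ) w => X2 t u₁ u₂ (-(k : ℤ)) w) (embDiff g) =
      embTwo ((u₁ * u₂) ^ L.length • qFun t⁻¹ L) * embDiff g := by
  induction L with
  | nil => simp
  | cons k L ih =>
    rw [List.foldr_cons, ih, X2, vertexMode_X2 ht, neg_neg, map_smul, qFun_cons,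
      ← smul_mul_assoc, ← map_smul, smul_smul, List.length_cons, pow_succ']

theorem foldl_X2 {t : K} (ht : ∀ n : ℕ, 0 < n → t ^ n ≠ 1)
    (u₁ u₂ : K) (L : List ℕ) (f g : Sym K) :
    L.foldl (fun w (k : ℕ) => X2 t u₁ u₂ (k : ℤ) w) (embTwo f * embDiff g) =
      embTwo (L.foldl (fun w (k : ℕ) => (u₁ * u₂) • vertex t⁻¹ 1 (-k) w) f) * embDiff g := by
  induction L generalizing f with
  | nil => simp
  | cons k L ih =>
    rw [List.foldl_cons, List.foldl_cons, X2, vertexMode_X2 ht, ← smul_mul_assoc, ← map_smul, ih]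

theorem constantCoeff_foldl_X1 {t : K} (ht : ∀ n : ℕ, 0 < n → t ^ n ≠ 1)
    (u₁ u₂ : K) (L : List ℕ) (hL : ∀ x ∈ L, 0 < x) (w : Fock K) :
    MvPolynomial.constantCoeff (L.foldl (fun w (k : ℕ) => X1 t u₁ u₂ (k : ℤ) w) w) =
      eps (L.foldl (fun w (k : ℕ) => u₁ • vertex t⁻¹ 1 (-k) w) (projOne w)) := by
  induction L generalizing w with
  | nil =>
    have h : (eps : Sym K →ₐ[K] K).comp projOne = MvPolynomial.aeval fun _ => 0 := by
      refine MvPolynomial.algHom_ext fun p => ?_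
      by_cases hp : p.1 = 0 <;> simp [projOne, eps, hp]
    have := DFunLike.congr_fun h w
    simp only [AlgHom.comp_apply] at this
    rw [List.foldl_nil, List.foldl_nil, this]
    simp [MvPolynomial.aeval_zero']
  | cons k L ih =>
    have hk := hL k (by simp)
    rw [List.foldl_cons, List.foldl_cons, ih fun x hx => hL x (by simp [hx]), X1,
      if_pos (by omega), if_neg (by omega), add_zero, Lambda1, map_smul,
      projOne_vertexMode_Lambda1 ht]

/-- Setting `b² = 0` turns the `b²` factor into its constant term and applies `ι` to the other. In
`eps_foldl_vertex` a second `ι` converts the bra's operators into `dualFun`; the two cancel in the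
first factor only. -/
theorem shapovalov_eq {t : K} (ht : ∀ n : ℕ, 0 < n → t ^ n ≠ 1)
    (u₁ u₂ : K) {m n : ℕ} (v : BiPartition m) (w : BiPartition n) :
    shapovalov t u₁ u₂ v w =
      (u₁ ^ len v.2.1 * u₂ ^ len w.2.1 *
        dualFun t⁻¹ (partsList v.2.1) (qFun t⁻¹ (partsList w.2.1))) *
      ((u₁ * u₂) ^ (len v.2.2 + len w.2.2) *
        dualFun t⁻¹ (partsList v.2.2) (iota (qFun t⁻¹ (partsList w.2.2)))) := by
  have h1 : ∀ f : Sym K, projOne (embTwo f) = MvPolynomial.C (eps f) := by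
    intro f
    have : (projOne : Fock K →ₐ[K] Sym K).comp embTwo =
        (Algebra.ofId K (Sym K)).comp eps :=
      MvPolynomial.algHom_ext fun k => by simp [projOne, embTwo, eps]
    exact DFunLike.congr_fun this f
  have h2 : ∀ g : Sym K, projOne (embDiff g) = iota g := by
    intro g
    have : (projOne : Fock K →ₐ[K] Sym K).comp embDiff = iota :=
      MvPolynomial.algHom_ext fun k => by simp [projOne, embDiff, iota]
    exact DFunLike.congr_fun this g
  rw [shapovalov, ket, bra, foldr_natCast, foldr_natCast, foldl_natCast, foldl_natCast, foldr_X1 ht _ _ _ (partsList_pos _), foldr_X2 ht, foldl_X2 ht,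
    constantCoeff_foldl_X1 ht _ _ _ (partsList_pos _), map_mul, h1, h2, eps_foldl_vertex,
    eps_foldl_vertex, ← MvPolynomial.smul_eq_C_mul]
  simp only [map_smul, iota_iota, length_partsList, smul_eq_mul, pow_add]
  ring

end Bridge

/-! ### Block and Kronecker structure of the Shapovalov matrix. -/

section Blocks

variable {K : Type*} [Field K]

/-- The factor of the Shapovalov matrix belonging to the first partitions. -/
def firstBlock (s u₁ u₂ : K) (n : ℕ) : Matrix n.Partition n.Partition K :=
  Matrix.diagonal fun lam => u₁ ^ len lam * u₂ ^ len lam * bList s (partsList lam)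

/-- The factor of the Shapovalov matrix belonging to the second partitions. -/
def secondBlock (s u : K) (n : ℕ) : Matrix n.Partition n.Partition K :=
  Matrix.of fun lam mu => u ^ (len lam + len mu) * pairing s n lam mu

/-- The inverse of `firstBlock`. -/
def firstBlockInv (s u₁ u₂ : K) (n : ℕ) : Matrix n.Partition n.Partition K :=
  Matrix.diagonal fun lam => (u₁ ^ len lam * u₂ ^ len lam * bList s (partsList lam))⁻¹

/-- The inverse of `secondBlock`. -/
def secondBlockInv (s u : K) (n : ℕ) : Matrix n.Partition n.Partition K :=
  Matrix.of fun lam mu => (u ^ (len lam + len mu))⁻¹ * pairingInv s n lam mu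

theorem firstBlock_mul_inv {s : K} (hs : ∀ n : ℕ, 0 < n → s ^ n ≠ 1)
    {u₁ u₂ : K} (hu₁ : u₁ ≠ 0) (hu₂ : u₂ ≠ 0) (n : ℕ) :
    firstBlock s u₁ u₂ n * firstBlockInv s u₁ u₂ n = 1 := by
  rw [firstBlock, firstBlockInv, Matrix.diagonal_mul_diagonal, ← Matrix.diagonal_one]
  congr 1
  funext lam
  exact mul_inv_cancel₀ (mul_ne_zero (mul_ne_zero (pow_ne_zero _ hu₁) (pow_ne_zero _ hu₂))
    (bList_ne_zero hs _))

/-- The inverse of the Shapovalov matrix. -/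
def shapovalovInv (t u₁ u₂ : K) (n : ℕ) : Matrix (BiPartition n) (BiPartition n) K :=
  Matrix.blockDiagonal' fun ab : {ab : ℕ × ℕ // ab ∈ antidiagonal n} =>
    Matrix.kroneckerMap (· * ·) (firstBlockInv t⁻¹ u₁ u₂ ab.1.1)
      (secondBlockInv t⁻¹ (u₁ * u₂) ab.1.2)

theorem shapovalovInv_emptyPair (t u₁ u₂ : K) {n : ℕ} (lam mu : n.Partition) :
    shapovalovInv t u₁ u₂ n (emptyPair lam) (emptyPair mu) =
      ((u₁ * u₂) ^ (len lam + len mu))⁻¹ * pairingInv t⁻¹ n lam mu := by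
  rw [shapovalovInv, emptyPair, emptyPair, Matrix.blockDiagonal'_apply_eq,
    Matrix.kroneckerMap_apply, firstBlockInv, Matrix.diagonal_apply_eq, secondBlockInv,
    Matrix.of_apply, ← length_partsList emptyPartition, partsList_emptyPartition]
  simp [bList]

variable [CharZero K]

theorem secondBlock_mul_inv {s : K} (hs : ∀ n : ℕ, 0 < n → s ^ n ≠ 1)
    {u : K} (hu : u ≠ 0) (n : ℕ) :
    secondBlock s u n * secondBlockInv s u n = 1 := by
  ext lam nu
  have h := congrFun (congrFun (pairing_mul_pairingInv hs n) lam) nu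
  rw [Matrix.mul_apply] at h ⊢
  have h1 : ∑ mu, secondBlock s u n lam mu * secondBlockInv s u n mu nu =
      u ^ len lam * (u ^ len nu)⁻¹ * ∑ mu, pairing s n lam mu * pairingInv s n mu nu := by
    rw [mul_sum]
    refine sum_congr rfl fun mu _ => ?_
    simp only [secondBlock, secondBlockInv, Matrix.of_apply, pow_add]
    have h1 := pow_ne_zero (len mu) hu
    field_simp
  rw [h1, h, Matrix.one_apply]
  split_ifs with h2
  · rw [h2, mul_one, mul_inv_cancel₀ (pow_ne_zero _ hu)]
  · rw [mul_zero]

/-- Orthogonality in the first partitions forces their sizes to agree, and at a fixed level the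
second sizes then agree as well. -/
theorem shapovalovMatrix_eq {t : K} (ht : ∀ n : ℕ, 0 < n → t ^ n ≠ 1) (u₁ u₂ : K) (n : ℕ) :
    shapovalovMatrix t u₁ u₂ n =
      Matrix.blockDiagonal' fun ab : {ab : ℕ × ℕ // ab ∈ antidiagonal n} =>
        Matrix.kroneckerMap (· * ·) (firstBlock t⁻¹ u₁ u₂ ab.1.1)
          (secondBlock t⁻¹ (u₁ * u₂) ab.1.2) := by
  ext v w
  obtain ⟨ab, lam₁, lam₂⟩ := v
  obtain ⟨cd, mu₁, mu₂⟩ := w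
  rw [shapovalovMatrix, Matrix.of_apply, shapovalov_eq ht]
  simp only [dualFun_qFun_partsList]
  by_cases h : ab = cd
  · subst h
    rw [Matrix.blockDiagonal'_apply_eq, Matrix.kroneckerMap_apply, firstBlock, secondBlock,
      Matrix.diagonal_apply, Matrix.of_apply, pairing, Matrix.of_apply]
    simp only [partsList_injective.eq_iff]
    congr 1
    split_ifs with h1
    · rw [h1]
    · rw [mul_zero]
  · rw [Matrix.blockDiagonal'_apply_ne _ _ _ h, if_neg, mul_zero, zero_mul]
    intro h1
    have h2 := congrArg List.sum h1
    rw [partsList_sum, partsList_sum] at h2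
    have h3 := HasAntidiagonal.mem_antidiagonal.1 ab.2
    have h4 := HasAntidiagonal.mem_antidiagonal.1 cd.2
    exact h (Subtype.ext (Prod.ext h2 (by omega)))

theorem shapovalovMatrix_mul_inv {t : K} (ht : ∀ n : ℕ, 0 < n → t ^ n ≠ 1) {u₁ u₂ : K}
    (hu₁ : u₁ ≠ 0) (hu₂ : u₂ ≠ 0) (n : ℕ) :
    shapovalovMatrix t u₁ u₂ n * shapovalovInv t u₁ u₂ n = 1 := by
  have hs : ∀ n : ℕ, 0 < n → t⁻¹ ^ n ≠ 1 := fun n hn h => ht n hn (by simpa using h)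
  rw [shapovalovMatrix_eq ht, shapovalovInv, ← Matrix.blockDiagonal'_mul,
    ← Matrix.blockDiagonal'_one]
  congr 1
  funext ab
  rw [← Matrix.mul_kronecker_mul, firstBlock_mul_inv hs hu₁ hu₂,
    secondBlock_mul_inv hs (mul_ne_zero hu₁ hu₂), Matrix.one_kronecker_one]
  rfl

theorem len_onePartition (n : ℕ) : len (onePartition n) = n := by
  rw [← length_partsList, partsList_onePartition, List.length_replicate]

end Blocks

end Crystal

end

theorem mainTheorem8 {K : Type*} [Field K] [CharZero K] (t u₁ u₂ : K)
    (ht₀ : t ≠ 0) (ht : ∀ n : ℕ, 0 < n → t ^ n ≠ 1) (hu₁ : u₁ ≠ 0) (hu₂ : u₂ ≠ 0) :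
    -- the Shapovalov matrix is block diagonal with respect to the level, with invertible blocks
    (∀ (m n : ℕ), m ≠ n → ∀ (v : Crystal.BiPartition m) (w : Crystal.BiPartition n),
      Crystal.shapovalov t u₁ u₂ v w = 0) ∧
    (∀ n : ℕ, IsUnit (Crystal.shapovalovMatrix t u₁ u₂ n)) ∧
    -- the explicit entries of its inverse
    (∀ (n : ℕ) (lam : n.Partition),
      (Crystal.shapovalovMatrix t u₁ u₂ n)⁻¹
          (Crystal.emptyPair (Crystal.onePartition n)) (Crystal.emptyPair lam) =
        (-1) ^ n * t ^ (-(Crystal.nStat lam : ℤ)) *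
          (u₁ * u₂) ^ (-(n : ℤ) - (Crystal.len lam : ℤ)) / Crystal.bFactor lam t⁻¹ ∧
      (Crystal.shapovalovMatrix t u₁ u₂ n)⁻¹
          (Crystal.emptyPair lam) (Crystal.emptyPair (Crystal.onePartition n)) =
        (-1) ^ n * t ^ (-(Crystal.nStat lam : ℤ)) *
          (u₁ * u₂) ^ (-(n : ℤ) - (Crystal.len lam : ℤ)) / Crystal.bFactor lam t⁻¹) := by
  have hs : ∀ n : ℕ, 0 < n → t⁻¹ ^ n ≠ 1 := fun n hn h => ht n hn (by simpa using h)
  refine ⟨fun m n hmn v w => ?_, fun n => ?_, fun n lam => ?_⟩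
  · rw [Crystal.shapovalov_eq ht, Crystal.dualFun_qFun_partsList]
    split_ifs with h
    -- Equal first partitions at different levels leave second partitions of different sizes, whose
    -- pairing vanishes by degree.
    · have h1 := congrArg List.sum h
      rw [Crystal.partsList_sum, Crystal.partsList_sum] at h1
      have h2 := Finset.HasAntidiagonal.mem_antidiagonal.1 v.1.2
      have h3 := Finset.HasAntidiagonal.mem_antidiagonal.1 w.1.2
      rw [Crystal.dualFun_eq_zero_of_mem t⁻¹
        (Crystal.iota_mem_degreeSpace (Crystal.qFun_partsList_mem t⁻¹ w.2.2)), mul_zero, mul_zero]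
      rw [Crystal.partsList_sum]
      omega
    · rw [mul_zero, zero_mul]
  · exact IsUnit.of_mul_eq_one _ (Crystal.shapovalovMatrix_mul_inv ht hu₁ hu₂ n)
  · have hexp : ∀ a : K, ((u₁ * u₂) ^ (n + Crystal.len lam))⁻¹ *
        ((-1) ^ n * t⁻¹ ^ Crystal.nStat lam / a) = (-1) ^ n * t ^ (-(Crystal.nStat lam : ℤ)) *
          (u₁ * u₂) ^ (-(n : ℤ) - (Crystal.len lam : ℤ)) / a := by
      intro a
      rw [show (-(n : ℤ) - (Crystal.len lam : ℤ)) = -((n + Crystal.len lam : ℕ) : ℤ) by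
        push_cast; ring, zpow_neg, zpow_neg, zpow_natCast, zpow_natCast, inv_pow]
      ring
    rw [Matrix.inv_eq_right_inv (Crystal.shapovalovMatrix_mul_inv ht hu₁ hu₂ n),
      Crystal.shapovalovInv_emptyPair, Crystal.shapovalovInv_emptyPair,
      Crystal.pairingInv_apply_onePartition hs,
      Crystal.pairingInv_onePartition_apply hs (inv_ne_zero ht₀), Crystal.len_onePartition,
      add_comm (Crystal.len lam), Crystal.hCoeff, ← Crystal.nStat_eq, ← Crystal.bFactor_eq, hexp]
    exact ⟨rfl, rfl⟩
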